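/- **Setting.** For every $n\ge 1$ let $k=k_n\le n$ and let $P_n=(p_{nj})_{j\le k}$ and $Q_n=(q_{nj})_{j\le k}$ be probability vectors (the alternative and the null hypothesis), where $k_n\to\infty$, $\max_j q_{nj}\to 0$ and, for some $\varrho>0$, $q_{nj}>\varrho/k_n$ for all $n\ge1$ and all $j$. For $\alpha>0$ put $$D_\alpha(P,Q)=\frac{1}{\alpha(\alpha-1)}\Big(\sum_j p_j^\alpha q_j^{1-\alpha}-1\Big)\ (\alpha\ne1),\qquad D_1(P,Q)=\sum_j p_j\ln\frac{p_j}{q_j}.$$ Let $\hat P_n$ be the vector of relative cell frequencies of $n$ independent observations with values in the $k_n$ cells, let $\hat D_{\alpha,n}=D_\alpha(\hat P_n,Q_n)$, and let $e_{\alpha,n}(x)=\mathsf P(\hat D_{\alpha,n}>x)$ when the observations have distribution $Q_n$. Let $0<\alpha_1<\alpha_2$, and assume that for each $\alpha\in\{\alpha_1,\alpha_2\}$ there is $0<\Delta_\alpha<\infty$ with $D_\alpha(P_n,Q_n)\to\Delta_\alpha$. **Definitions.** Let $L_\alpha=\{x>0: 1+\alpha(\alpha-1)x>0\}$, that is, $]0,\infty[$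 if $\alpha\ge1$ and $]0,\frac1{\alpha(1-\alpha)}[$ if $\alpha<1$. A continuous function $g_\alpha:L_\alpha\to\,]0,\infty[$ is a *Bahadur function* of $\hat D_{\alpha,n}$ generated by a sequence $c_\alpha(n)$, positive for all large $n$, if $-\frac{c_\alpha(n)}n\ln e_{\alpha,n}(x)\to g_\alpha(x)$ for all $x\in L_\alpha$. The statistic $\hat D_{\alpha,n}$ is *consistent* if it tends in probability to $\Delta_\alpha$ under $P_n$ and to $0$ under $Q_n$. A number $B\in[0,\infty]$ is a *Bahadur efficiency* of $\hat D_{\alpha_1,n}$ with respect to $\hat D_{\alpha_2,n}$ if both statistics are consistent, $\Delta_{\alpha_i}\in L_{\alpha_i}$ for $i=1,2$, and there are Bahadur functions $g_{\alpha_i}$ generated by sequences $c_{\alpha_i}(n)$, and sample sizes $m_n\to\infty$, such that $$\frac{m_n}{c_{\alpha_2}(m_n)}=\frac{g_{\alpha_1}(\Delta_{\alpha_1})}{g_{\alpha_2}(\Delta_{\alpha_2})}\cdot\frac{n}{c_{\alpha_1}(n)}\,(1+o(1)),\qquad \frac{c_{\alpha_2}(m_n)}{c_{\alpha_1}(n)}\to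 c_{\alpha_2/\alpha_1}\in[0,\infty],\qquad B=\frac{g_{\alpha_1}(\Delta_{\alpha_1})}{g_{\alpha_2}(\Delta_{\alpha_2})}\cdot c_{\alpha_2/\alpha_1}.$$ **Theorem.** (i) Let $\frac{k_n\ln n}{n}\to0$. If $\alpha_2<1$ and $1+\alpha_2(\alpha_2-1)\Delta_{\alpha_2}>0$, then $\hat D_{\alpha_1,n}$ has one and only one Bahadur efficiency with respect to $\hat D_{\alpha_2,n}$, and it equals $$\frac{\alpha_2-1}{\alpha_1-1}\cdot\frac{\ln(1+\alpha_1(\alpha_1-1)\Delta_{\alpha_1})}{\ln(1+\alpha_2(\alpha_2-1)\Delta_{\alpha_2})}.$$ If $\alpha_2=1$, then it has one and only one, and it equals $$\frac{1}{\alpha_1-1}\cdot\frac{\ln(1+\alpha_1(\alpha_1-1)\Delta_{\alpha_1})}{\Delta_{\alpha_2}}.$$ (ii) Let $k_n$ be nondecreasing, let $Q_n$ be uniform, $q_{nj}=1/k_n$ for all $j$ and $n\ge1$, and let $\frac{k_n^{2-1/\alpha_2}\ln n}{n}\to0$ and $\alpha_2>1$. Then $\infty$ is a Bahadur efficiency of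 $\hat D_{\alpha_1,n}$ with respect to $\hat D_{\alpha_2,n}$. It is the only one if $\alpha_1\le1$ or if there is a constant $C$ with $m\,k_n\le C\,n\,k_m$ for all $m\le n$. -/

import Mathlib

open MeasureTheory Filter Topology Asymptotics

noncomputable section

namespace PowerDivergence

/-- The power divergence `D_α(p, q)` of two vectors on `k` cells; for `α = 1` it is the information
divergence. It is used for `α > 0` and `q` with positive coordinates, where `0 ^ α = 0` and
`0 * log 0 = 0` are the usual conventions. -/
def powerDiv {k : ℕ} (α : ℝ) (p q : Fin k → ℝ) : ℝ :=
  if α = 1 then ∑ j, p j * Real.log (p j / q j)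
  else 1 / (α * (α - 1)) * (∑ j, p j ^ α * q j ^ (1 - α) - 1)

/-- The joint law of the cells of `n` independent observations, each of which falls into the
cell `j` with probability `p j`. -/
def sampleLaw {k : ℕ} (p : Fin k → ℝ) (n : ℕ) : Measure (Fin n → Fin k) :=
  Measure.pi fun _ => ∑ j, ENNReal.ofReal (p j) • Measure.dirac j

/-- The empirical distribution (vector of relative cell frequencies) of the sample `ω`. -/
def empirical {k n : ℕ} (ω : Fin n → Fin k) : Fin k → ℝ :=
  fun j => ((Finset.univ.filter fun i => ω i = j).card : ℝ) / n

/-- The power divergence statistic of the sample `ω` for the hypothetical distribution `q`. -/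
def statistic {k n : ℕ} (α : ℝ) (q : Fin k → ℝ) (ω : Fin n → Fin k) : ℝ :=
  powerDiv α (empirical ω) q

/-- `P n` and `Q n` are probability vectors on `k n ≤ n` cells for every sample size `n ≥ 1`, and
the number of cells tends to infinity. -/
structure CellModel (k : ℕ → ℕ) (P Q : (n : ℕ) → Fin (k n) → ℝ) : Prop where
  card_le : ∀ n, k n ≤ n
  card_tendsto : Tendsto k atTop atTop
  alternative_mem : ∀ n, 1 ≤ n → P n ∈ stdSimplex ℝ (Fin (k n))
  null_mem : ∀ n, 1 ≤ n → Q n ∈ stdSimplex ℝ (Fin (k n))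

/-- The hypothetical distributions are regular: their largest cell probability tends to zero and
all cell probabilities exceed a fixed multiple of `1 / k`. -/
structure RegularNull (k : ℕ → ℕ) (Q : (n : ℕ) → Fin (k n) → ℝ) : Prop where
  max_tendsto : Tendsto (fun n => ⨆ j, Q n j) atTop (𝓝 0)
  lower_bound : ∃ ρ : ℝ, 0 < ρ ∧ ∀ n, 1 ≤ n → ∀ j, ρ / k n < Q n j

/-- The alternative is identifiable in the order `α`, with the limit `Δ`. -/
structure Identifiable (k : ℕ → ℕ) (P Q : (n : ℕ) → Fin (k n) → ℝ) (α Δ : ℝ) : Prop where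
  pos : 0 < Δ
  tendsto : Tendsto (fun n => powerDiv α (P n) (Q n)) atTop (𝓝 Δ)

/-- The assumption on the model under which two orders are compared. -/
structure Assumptions (k : ℕ → ℕ) (P Q : (n : ℕ) → Fin (k n) → ℝ) (α₁ α₂ Δ₁ Δ₂ : ℝ) : Prop where
  model : CellModel k P Q
  regular : RegularNull k Q
  identifiable₁ : Identifiable k P Q α₁ Δ₁
  identifiable₂ : Identifiable k P Q α₂ Δ₂

/-- The statistic is consistent with parameter `Δ`: it tends to `Δ` in probability under the
alternative, and to `0` in probability under the hypothesis. -/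
def IsConsistent (k : ℕ → ℕ) (P Q : (n : ℕ) → Fin (k n) → ℝ) (α Δ : ℝ) : Prop :=
  (∀ ε : ℝ, 0 < ε →
    Tendsto (fun n => (sampleLaw (P n) n).real {ω | ε ≤ |statistic α (Q n) ω - Δ|})
      atTop (𝓝 0)) ∧
  (∀ ε : ℝ, 0 < ε →
    Tendsto (fun n => (sampleLaw (Q n) n).real {ω | ε ≤ |statistic α (Q n) ω|}) atTop (𝓝 0))

/-- The error probability at the level `x`: the probability, under the hypothesis, that the
statistic exceeds `x`. -/
def errorProb (k : ℕ → ℕ) (Q : (n : ℕ) → Fin (k n) → ℝ) (α : ℝ) (n : ℕ) (x : ℝ) : ℝ :=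
  (sampleLaw (Q n) n).real {ω | x < statistic α (Q n) ω}

/-- The levels at which a Bahadur function of order `α` is considered: all `x > 0` if `1 ≤ α`, and
`0 < x < 1 / (α * (1 - α))` if `0 < α < 1`, because in this case the divergence never exceeds
`1 / (α * (1 - α))`, so that the error probabilities at higher levels are zero. -/
def levels (α : ℝ) : Set ℝ := {x | 0 < x ∧ 0 < 1 + α * (α - 1) * x}

/-- `g` is the Bahadur function of the statistic of order `α` generated by the sequence `c`. As `g`
is positive, the limit relation forces the error probabilities to be eventually nonzero. -/
structure IsBahadurFunction (k : ℕ → ℕ) (Q : (n : ℕ) → Fin (k n) → ℝ) (α : ℝ)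
    (g : ℝ → ℝ) (c : ℕ → ℝ) : Prop where
  continuousOn : ContinuousOn g (levels α)
  pos : ∀ x ∈ levels α, 0 < g x
  generator_pos : ∀ᶠ n in atTop, 0 < c n
  tendsto : ∀ x ∈ levels α,
    Tendsto (fun n : ℕ => -(c n / n) * Real.log (errorProb k Q α n x)) atTop (𝓝 (g x))

/-- `B ∈ [0, ∞]` is a Bahadur efficiency of the statistic of order `α₁` with respect to the one of
order `α₂`. Here `m n` is the sample size at which the second statistic has asymptotically the
same error exponent as the first one has at the sample size `n`. -/
def IsBahadurEfficiency (k : ℕ → ℕ) (P Q : (n : ℕ) → Fin (k n) → ℝ) (α₁ α₂ Δ₁ Δ₂ : ℝ)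
    (B : ENNReal) : Prop :=
  IsConsistent k P Q α₁ Δ₁ ∧ IsConsistent k P Q α₂ Δ₂ ∧
  Δ₁ ∈ levels α₁ ∧ Δ₂ ∈ levels α₂ ∧
  ∃ (g₁ g₂ : ℝ → ℝ) (c₁ c₂ : ℕ → ℝ) (m : ℕ → ℕ) (c : ENNReal),
    IsBahadurFunction k Q α₁ g₁ c₁ ∧ IsBahadurFunction k Q α₂ g₂ c₂ ∧
    Tendsto m atTop atTop ∧
    (fun n => (m n : ℝ) / c₂ (m n)) ~[atTop] (fun n => g₁ Δ₁ / g₂ Δ₂ * ((n : ℝ) / c₁ n)) ∧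
    Tendsto (fun n => ENNReal.ofReal (c₂ (m n) / c₁ n)) atTop (𝓝 c) ∧
    B = ENNReal.ofReal (g₁ Δ₁ / g₂ Δ₂) * c

end PowerDivergence

end

/-! Everything rests on the exponential rate of the error probability. By the method of types
(`sampleLaw_klDiv_ge_le`) the null probability of `D_α > x` is at most `(n+1)^k * exp(-n b)`, where
`b` is any lower bound for the information divergence on `{D_α > x}`. The growth conditions on `k`
make the factor `(n+1)^k` negligible, so the rate is found by solving a deterministic minimisation
problem and exhibiting an event that attains the minimum.

For `α ≤ 1`, Jensen's inequality gives `b = renyiLevel α x`. It is attained by letting all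
observations fall into a set of cells of null mass just below `exp(-b)`; such sets exist because the
largest cell probability tends to zero. The generator is therefore constant
(`isBahadurFunction_renyiLevel`), the ratio of generators is 1, and the efficiency is the quotient
of the two Bahadur functions.

For `α > 1` and uniform hypotheses it is far cheaper to overload a single cell: relative frequency
`A / K^(1-1/α)` in one of `K` cells already contributes `A^α` to the power sum, at a cost of about
`(A/α) log K / K^(1-1/α)` per observation. That nothing is cheaper is `eventually_le_klDiv_uniform`.
The generator is thus `peakRate α (k n)`, which tends to infinity, and faster for larger `α`
(`isBahadurFunction_peakLevel`). The second statistic then needs sample sizes for which the ratio of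
generators diverges, hence efficiency `∞`.

Consistency under the alternative follows because the empirical distribution is close to `P n` in
information divergence with high probability, and the divergences are stable under such
perturbations; under the hypothesis it follows from the Bahadur functions. Uniqueness holds because
generators of the same statistic agree up to asymptotically constant factors
(`tendsto_generator_div`), so any efficiency may be computed with the explicit generators. -/

namespace PowerDivergence

/-! ### Laws of empirical distributions: types, Chebyshev's inequality, binomial lower bounds. -/

section Law

variable {k n : ℕ} {p : Fin k → ℝ}

lemma isProbabilityMeasure_sum_dirac (hp : p ∈ stdSimplex ℝ (Fin k)) :
    IsProbabilityMeasure (∑ j, ENNReal.ofReal (p j) • Measure.dirac j : Measure (Fin k)) := by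
  constructor
  simp only [Measure.coe_finsetSum, Finset.sum_apply, Measure.smul_apply, measure_univ,
    smul_eq_mul, mul_one]
  rw [← ENNReal.ofReal_sum_of_nonneg fun j _ => hp.1 j, hp.2, ENNReal.ofReal_one]

lemma isProbabilityMeasure_sampleLaw (hp : p ∈ stdSimplex ℝ (Fin k)) (n : ℕ) :
    IsProbabilityMeasure (sampleLaw p n) := by
  have := isProbabilityMeasure_sum_dirac hp
  unfold sampleLaw
  infer_instance

lemma sum_dirac_apply (s : Set (Fin k)) [DecidablePred (· ∈ s)] :
    (∑ j, ENNReal.ofReal (p j) • Measure.dirac j : Measure (Fin k)) s =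
      ∑ j with j ∈ s, ENNReal.ofReal (p j) := by
  simp only [Measure.coe_finsetSum, Finset.sum_apply, Measure.smul_apply, smul_eq_mul]
  rw [Finset.sum_filter]
  refine Finset.sum_congr rfl fun j _ => ?_
  rw [Measure.dirac_apply' _ (Set.toFinite s).measurableSet]
  by_cases h : j ∈ s <;> simp [h]

lemma sampleLaw_real_pi (hp : p ∈ stdSimplex ℝ (Fin k)) (s : Fin n → Finset (Fin k)) :
    (sampleLaw p n).real {ω | ∀ i, ω i ∈ s i} = ∏ i, ∑ j ∈ s i, p j := by
  have := isProbabilityMeasure_sum_dirac hp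
  have h : {ω : Fin n → Fin k | ∀ i, ω i ∈ s i} = Set.univ.pi fun i => (s i : Set (Fin k)) := by
    ext; simp
  rw [h, measureReal_def, sampleLaw, Measure.pi_pi, ENNReal.toReal_prod]
  refine Finset.prod_congr rfl fun i _ => ?_
  classical
  rw [sum_dirac_apply, ← ENNReal.ofReal_sum_of_nonneg fun j _ => hp.1 j, ENNReal.toReal_ofReal
    (Finset.sum_nonneg fun j _ => hp.1 j)]
  simp

lemma sampleLaw_real_singleton (hp : p ∈ stdSimplex ℝ (Fin k)) (ω : Fin n → Fin k) :
    (sampleLaw p n).real {ω} = ∏ i, p (ω i) := by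
  have h := sampleLaw_real_pi hp fun i => {ω i}
  have h' : {ω' : Fin n → Fin k | ∀ i, ω' i ∈ ({ω i} : Finset _)} = {ω} := by
    ext; simp [funext_iff]
  rw [h'] at h
  simpa using h

lemma sampleLaw_real_eq_sum (hp : p ∈ stdSimplex ℝ (Fin k)) (A : Set (Fin n → Fin k))
    [DecidablePred (· ∈ A)] :
    (sampleLaw p n).real A = ∑ ω with ω ∈ A, ∏ i, p (ω i) := by
  have := isProbabilityMeasure_sampleLaw hp n
  have h : A = ((Finset.univ.filter (· ∈ A) : Finset (Fin n → Fin k)) : Set _) := by ext; simp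
  conv_lhs => rw [h]
  rw [← sum_measureReal_singleton]
  exact Finset.sum_congr rfl fun ω _ => sampleLaw_real_singleton hp ω

lemma sum_empirical_mul (ω : Fin n → Fin k) (f : Fin k → ℝ) :
    ∑ j, empirical ω j * f j = (∑ i, f (ω i)) / n := by
  simp only [empirical, Finset.card_filter, Nat.cast_sum, div_mul_eq_mul_div, Finset.sum_mul]
  rw [← Finset.sum_div, Finset.sum_comm]
  congr 1
  refine Finset.sum_congr rfl fun i _ => ?_
  simp [ite_mul]

lemma empirical_nonneg (ω : Fin n → Fin k) (j : Fin k) : 0 ≤ empirical ω j := by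
  unfold empirical; positivity

lemma empirical_mem (hn : 1 ≤ n) (ω : Fin n → Fin k) :
    empirical ω ∈ stdSimplex ℝ (Fin k) := by
  refine ⟨empirical_nonneg ω, ?_⟩
  have h := sum_empirical_mul ω fun _ => (1 : ℝ)
  have : (n : ℝ) ≠ 0 := by positivity
  simpa [this] using h

lemma empirical_apply_pos (ω : Fin n → Fin k) (i : Fin n) : 0 < empirical ω (ω i) := by
  have : 0 < n := i.pos
  refine div_pos ?_ (by positivity)
  exact_mod_cast Finset.card_pos.2 ⟨i, by simp⟩

lemma empirical_eq_zero {ω : Fin n → Fin k} {j : Fin k} (h : ∀ i, ω i ≠ j) :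
    empirical ω j = 0 := by
  simp [empirical, h]

lemma mul_klDiv_empirical (hn : 1 ≤ n) (ω : Fin n → Fin k) (q : Fin k → ℝ) :
    n * powerDiv 1 (empirical ω) q = ∑ i, Real.log (empirical ω (ω i) / q (ω i)) := by
  rw [powerDiv, if_pos rfl, sum_empirical_mul ω fun j => Real.log (empirical ω j / q j)]
  field_simp

lemma card_image_empirical_le (k n : ℕ) :
    (Finset.univ.image (empirical : (Fin n → Fin k) → Fin k → ℝ)).card ≤ (n + 1) ^ k := by
  classical
  calc _ ≤ (Finset.univ.image fun (c : Fin k → Fin (n + 1)) j => ((c j : ℕ) : ℝ) / n).card := by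
        refine Finset.card_le_card fun τ hτ => ?_
        obtain ⟨ω, -, rfl⟩ := Finset.mem_image.1 hτ
        refine Finset.mem_image.2 ⟨fun j => ⟨(Finset.univ.filter fun i => ω i = j).card, ?_⟩,
          Finset.mem_univ _, rfl⟩
        exact Nat.lt_succ_of_le ((Finset.card_filter_le _ _).trans (by simp))
    _ ≤ _ := Finset.card_image_le.trans (by simp)

/-- The method of types: large deviations of the information divergence. -/
lemma sampleLaw_klDiv_ge_le (hn : 1 ≤ n) (hp : p ∈ stdSimplex ℝ (Fin k)) (c : ℝ) :
    (sampleLaw p n).real {ω | c ≤ powerDiv 1 (empirical ω) p} ≤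
      (n + 1 : ℝ) ^ k * Real.exp (-(n * c)) := by
  classical
  -- The likelihood of a sample under `p`, times `exp(n D)`, is its likelihood under its own type.
  -- This is an equality unless the sample hits a cell of probability zero, where the left side
  -- vanishes.
  have key : ∀ ω : Fin n → Fin k, (∏ i, p (ω i)) * Real.exp (n * powerDiv 1 (empirical ω) p) ≤
      ∏ i, empirical ω (ω i) := by
    intro ω
    by_cases h : ∀ i, 0 < p (ω i)
    · rw [mul_klDiv_empirical hn, Real.exp_sum, ← Finset.prod_mul_distrib]
      refine (Finset.prod_congr rfl fun i _ => ?_).le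
      rw [Real.exp_log (div_pos (empirical_apply_pos ω i) (h i)), mul_div_cancel₀ _ (h i).ne']
    · push Not at h
      obtain ⟨i, hi⟩ := h
      rw [Finset.prod_eq_zero (Finset.mem_univ i) (le_antisymm hi (hp.1 _)), zero_mul]
      exact Finset.prod_nonneg fun i _ => empirical_nonneg _ _
  -- Grouped by type: each type class has probability at most 1 under the product law of its own
  -- type, so the sum is at most the number of types.
  have types : ∑ ω : Fin n → Fin k, ∏ i, empirical ω (ω i) ≤ (n + 1 : ℝ) ^ k := by
    rw [← Finset.sum_fiberwise_of_maps_to (s := Finset.univ) (t := Finset.univ.image empirical)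
      (g := empirical) fun ω _ => Finset.mem_image_of_mem _ (Finset.mem_univ _)]
    calc _ ≤ ∑ τ ∈ Finset.univ.image (empirical : (Fin n → Fin k) → Fin k → ℝ), (1 : ℝ) := by
          refine Finset.sum_le_sum fun τ hτ => ?_
          obtain ⟨ω₀, -, rfl⟩ := Finset.mem_image.1 hτ
          calc _ = ∑ ω : Fin n → Fin k with empirical ω = empirical ω₀,
                ∏ i, empirical ω₀ (ω i) := by
                refine Finset.sum_congr rfl fun ω hω => ?_
                rw [(Finset.mem_filter.1 hω).2]
            _ ≤ ∑ ω : Fin n → Fin k, ∏ i, empirical ω₀ (ω i) :=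
                Finset.sum_le_sum_of_subset_of_nonneg (Finset.filter_subset _ _)
                  fun _ _ _ => Finset.prod_nonneg fun i _ => empirical_nonneg _ _
            _ = 1 := by
                have := Finset.sum_prod_piFinset (ι := Fin n) (Finset.univ : Finset (Fin k))
                  fun _ => empirical ω₀
                rw [Fintype.piFinset_univ] at this
                rw [this, (empirical_mem hn ω₀).2]
                simp
      _ ≤ _ := by
          rw [Finset.sum_const, nsmul_eq_mul, mul_one]
          exact_mod_cast card_image_empirical_le k n
  rw [sampleLaw_real_eq_sum hp]
  calc _ ≤ ∑ ω : Fin n → Fin k, (∏ i, empirical ω (ω i)) * Real.exp (-(n * c)) := by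
        refine (Finset.sum_le_sum fun ω hω => ?_).trans
          (Finset.sum_le_sum_of_subset_of_nonneg (Finset.filter_subset _ _) fun ω _ _ =>
            mul_nonneg (Finset.prod_nonneg fun i _ => empirical_nonneg _ _) (Real.exp_pos _).le)
        have h1 : c ≤ powerDiv 1 (empirical ω) p := by simpa using hω
        have h2 : n * c ≤ n * powerDiv 1 (empirical ω) p := by gcongr
        calc ∏ i, p (ω i) = (∏ i, p (ω i)) * Real.exp (n * c) * Real.exp (-(n * c)) := by
              rw [mul_assoc, ← Real.exp_add]; simp
          _ ≤ _ := by
              gcongr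
              refine le_trans ?_ (key ω)
              gcongr
              exact Finset.prod_nonneg fun i _ => hp.1 _
    _ ≤ _ := by
        rw [← Finset.sum_mul]
        gcongr

/-- Almost surely, cells of probability zero stay empty. -/
lemma sampleLaw_real_le_of_ac (hp : p ∈ stdSimplex ℝ (Fin k)) {A B : Set (Fin n → Fin k)}
    (h : ∀ ω ∈ A, (∀ j, p j = 0 → empirical ω j = 0) → ω ∈ B) :
    (sampleLaw p n).real A ≤ (sampleLaw p n).real B := by
  classical
  rw [sampleLaw_real_eq_sum hp, sampleLaw_real_eq_sum hp, Finset.sum_filter, Finset.sum_filter]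
  refine Finset.sum_le_sum fun ω _ => ?_
  have h0 : 0 ≤ ∏ i, p (ω i) := Finset.prod_nonneg fun i _ => hp.1 _
  by_cases hA : ω ∈ A
  · by_cases hac : ∀ j, p j = 0 → empirical ω j = 0
    · simp [hA, h ω hA hac]
    · push Not at hac
      obtain ⟨j, hj, hj'⟩ := hac
      have : ∃ i, ω i = j := by
        by_contra! hi
        exact hj' (empirical_eq_zero hi)
      obtain ⟨i, rfl⟩ := this
      rw [Finset.prod_eq_zero (Finset.mem_univ i) hj]
      simp
  · simp only [hA, if_false]
    split_ifs <;> simp [h0]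

/-- Chebyshev's inequality, with the variance bounded by the second moment. It serves the order `α =
1`, where `f` is the log-likelihood ratio. -/
lemma sampleLaw_sum_empirical_ge_le (hn : 1 ≤ n) (hp : p ∈ stdSimplex ℝ (Fin k))
    (f : Fin k → ℝ) {ε : ℝ} (hε : 0 < ε) :
    (sampleLaw p n).real {ω | ε ≤ |∑ j, empirical ω j * f j - ∑ j, p j * f j|} ≤
      (∑ j, p j * f j ^ 2) / (n * ε ^ 2) := by
  have h1 := isProbabilityMeasure_sum_dirac hp
  have h2 := isProbabilityMeasure_sampleLaw hp n
  have hn0 : (0 : ℝ) < n := by exact_mod_cast hn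
  have hint : ∀ g : Fin k → ℝ,
      ∫ j, g j ∂(∑ j, ENNReal.ofReal (p j) • Measure.dirac j : Measure (Fin k)) =
        ∑ j, p j * g j := by
    intro g
    rw [integral_finsetSum_measure fun j _ => (Integrable.of_finite (μ := Measure.dirac j)).smul_measure
      ENNReal.ofReal_ne_top]
    refine Finset.sum_congr rfl fun j _ => ?_
    rw [integral_smul_measure, integral_dirac, ENNReal.toReal_ofReal (hp.1 j), smul_eq_mul]
  have hmem : ∀ i : Fin n,
      MemLp f 2 (∑ j, ENNReal.ofReal (p j) • Measure.dirac j : Measure (Fin k)) :=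
    fun i => MemLp.of_discrete
  have hvar := ProbabilityTheory.variance_sum_pi (X := fun _ : Fin n => f) hmem
  have hexp : ∫ ω, (∑ i : Fin n, fun ω : Fin n → Fin k => f (ω i)) ω ∂(sampleLaw p n) =
      n * ∑ j, p j * f j := by
    simp only [Finset.sum_apply]
    rw [integral_finsetSum _ fun i _ => Integrable.of_finite]
    have : ∀ i : Fin n, ∫ ω, f (ω i) ∂(sampleLaw p n) = ∑ j, p j * f j := by
      intro i
      rw [← hint]
      exact integral_comp_eval (μ := fun _ : Fin n => (∑ j, ENNReal.ofReal (p j) • Measure.dirac j))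
        (f := f) AEStronglyMeasurable.of_discrete
    simp [this]
  have hm : MemLp (∑ i : Fin n, fun ω : Fin n → Fin k => f (ω i)) 2 (sampleLaw p n) :=
    MemLp.of_discrete
  have hc := ProbabilityTheory.meas_ge_le_variance_div_sq hm (c := n * ε) (by positivity)
  rw [hexp] at hc
  have hset : {ω : Fin n → Fin k | ε ≤ |∑ j, empirical ω j * f j - ∑ j, p j * f j|} =
      {ω | n * ε ≤ |(∑ i : Fin n, fun ω : Fin n → Fin k => f (ω i)) ω - n * ∑ j, p j * f j|} := by
    ext ω
    simp only [Set.mem_ofPred_eq, Finset.sum_apply]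
    rw [sum_empirical_mul]
    have : (∑ i, f (ω i)) - n * ∑ j, p j * f j =
        n * ((∑ i, f (ω i)) / n - ∑ j, p j * f j) := by field_simp
    rw [this, abs_mul, abs_of_pos hn0, mul_le_mul_iff_right₀ hn0]
  have hle : ∑ i : Fin n, ProbabilityTheory.variance f
      (∑ j, ENNReal.ofReal (p j) • Measure.dirac j : Measure (Fin k)) ≤
        n * ∑ j, p j * f j ^ 2 := by
    rw [Finset.sum_const, Finset.card_univ, Fintype.card_fin, nsmul_eq_mul]
    gcongr
    refine (ProbabilityTheory.variance_le_expectation_sq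
      AEStronglyMeasurable.of_discrete).trans_eq ?_
    rw [← hint]
    rfl
  rw [hset, measureReal_def]
  refine ENNReal.toReal_le_of_le_ofReal ?_ (hc.trans (ENNReal.ofReal_le_ofReal ?_))
  · exact div_nonneg (Finset.sum_nonneg fun j _ => mul_nonneg (hp.1 j) (sq_nonneg _))
      (by positivity)
  · unfold sampleLaw
    rw [hvar]
    calc _ ≤ (n * ∑ j, p j * f j ^ 2) / (n * ε) ^ 2 := by gcongr
      _ = _ := by field_simp

/-- Induction through `(n+1) * C(n,a) = (a+1) * C(n+1,a+1)`, using `(n+1)/(a+1) ≤ n/a` for `a ≤ n`.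
-/
lemma div_pow_le_choose : ∀ {a n : ℕ}, a ≤ n → ((n : ℝ) / a) ^ a ≤ n.choose a
  | 0, n, _ => by simp
  | a + 1, 0, h => by simp at h
  | a + 1, n + 1, h => by
      have ih := div_pow_le_choose (Nat.le_of_succ_le_succ h)
      have hle : (a : ℝ) ≤ n := by exact_mod_cast Nat.le_of_succ_le_succ h
      have h1 : ((n + 1 : ℝ) / (a + 1)) ^ a ≤ (n.choose a : ℝ) := by
        rcases Nat.eq_zero_or_pos a with rfl | ha
        · simp
        refine le_trans ?_ ih
        have : (0 : ℝ) < a := by exact_mod_cast ha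
        gcongr ?_ ^ a
        rw [div_le_div_iff₀ (by positivity) (by positivity)]
        nlinarith
      have h2 : ((n + 1 : ℝ)) * n.choose a = (n + 1).choose (a + 1) * (a + 1) := by
        exact_mod_cast Nat.add_one_mul_choose_eq n a
      push_cast
      rw [pow_succ, mul_comm]
      calc _ ≤ (n + 1 : ℝ) / (a + 1) * n.choose a := by gcongr
        _ = _ := by rw [div_mul_eq_mul_div, h2]; field_simp

/-- A lower bound for a binomial probability. -/
lemma le_sampleLaw_empirical_eq (hp : p ∈ stdSimplex ℝ (Fin k)) (j : Fin k) {a : ℕ}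
    (ha : a ≤ n) :
    ((n : ℝ) / a) ^ a * (p j ^ a * (1 - p j) ^ (n - a)) ≤
      (sampleLaw p n).real {ω | empirical ω j = a / n} := by
  classical
  have := isProbabilityMeasure_sampleLaw hp n
  have hj : p j ≤ 1 := hp.2 ▸ Finset.single_le_sum (fun i _ => hp.1 i) (Finset.mem_univ j)
  have hcomp : ∑ i ∈ ({j}ᶜ : Finset (Fin k)), p i = 1 - p j := by
    have := Finset.sum_add_sum_compl ({j} : Finset (Fin k)) p
    rw [hp.2, Finset.sum_singleton] at this
    linarith
  -- `E S` says that exactly the observations with index in `S` fall into the cell `j`. These events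
  -- are disjoint, and for `S` of size `a` all have the same probability.
  let E : Finset (Fin n) → Set (Fin n → Fin k) := fun S =>
    {ω | ∀ i, ω i ∈ if i ∈ S then ({j} : Finset (Fin k)) else {j}ᶜ}
  have hE : ∀ S ω, ω ∈ E S ↔ Finset.univ.filter (fun i => ω i = j) = S := by
    intro S ω
    simp only [E, Set.mem_ofPred_eq, Finset.ext_iff, Finset.mem_filter, Finset.mem_univ, true_and]
    refine forall_congr' fun i => ?_
    by_cases h : i ∈ S <;> simp [h]
  have hmE : ∀ S ∈ Finset.powersetCard a (Finset.univ : Finset (Fin n)),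
      (sampleLaw p n).real (E S) = p j ^ a * (1 - p j) ^ (n - a) := by
    intro S hS
    rw [sampleLaw_real_pi hp]
    have : ∀ i, ∑ l ∈ (if i ∈ S then ({j} : Finset (Fin k)) else {j}ᶜ), p l =
        if i ∈ S then p j else 1 - p j := by
      intro i; split_ifs
      · simp
      · exact hcomp
    simp_rw [this]
    rw [Finset.prod_ite, Finset.prod_const, Finset.prod_const, Finset.filter_not]
    have hc := (Finset.mem_powersetCard.1 hS).2
    simp [Finset.card_univ_sdiff, hc]
  calc _ ≤ (n.choose a : ℝ) * (p j ^ a * (1 - p j) ^ (n - a)) := by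
        have := div_pow_le_choose ha
        have h0 := hp.1 j
        have h1 : 0 ≤ 1 - p j := by linarith
        gcongr
    _ = ∑ S ∈ Finset.powersetCard a (Finset.univ : Finset (Fin n)), (sampleLaw p n).real (E S) := by
        rw [Finset.sum_congr rfl hmE]
        simp
    _ = (sampleLaw p n).real (⋃ S ∈ Finset.powersetCard a (Finset.univ : Finset (Fin n)), E S) := by
        rw [measureReal_biUnion_finset]
        · intro S _ T _ hST
          refine Set.disjoint_left.2 fun ω hS hT => hST ?_
          rw [← (hE S ω).1 hS, (hE T ω).1 hT]
        · exact fun S _ => (Set.toFinite _).measurableSet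
    _ ≤ _ := by
        refine measureReal_mono fun ω hω => ?_
        simp only [Set.mem_iUnion] at hω
        obtain ⟨S, hS, hω⟩ := hω
        rw [hE] at hω
        simp only [empirical, Set.mem_ofPred_eq, hω, (Finset.mem_powersetCard.1 hS).2]

end Law

end PowerDivergence

namespace PowerDivergence

/-! ### Inequalities between power sums and the information divergence. -/

section Inequalities

lemma sum_rpow_mul_rpow_le {ι : Type*} (s : Finset ι) {a b : ι → ℝ} (ha : ∀ i ∈ s, 0 ≤ a i)
    (hb : ∀ i ∈ s, 0 ≤ b i) {θ : ℝ} (h0 : 0 < θ) (h1 : θ < 1) :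
    ∑ i ∈ s, a i ^ θ * b i ^ (1 - θ) ≤ (∑ i ∈ s, a i) ^ θ * (∑ i ∈ s, b i) ^ (1 - θ) := by
  have h2 : 0 < 1 - θ := by linarith
  have h := Real.inner_le_Lp_mul_Lq_of_nonneg s
    (Real.holderConjugate_one_div h0 h2 (by ring))
    (fun i hi => Real.rpow_nonneg (ha i hi) θ) (fun i hi => Real.rpow_nonneg (hb i hi) (1 - θ))
  simp only [one_div_one_div] at h
  refine h.trans_eq ?_
  congr 2
  · refine Finset.sum_congr rfl fun i hi => ?_
    rw [← Real.rpow_mul (ha i hi), mul_one_div_cancel h0.ne', Real.rpow_one]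
  · refine Finset.sum_congr rfl fun i hi => ?_
    rw [← Real.rpow_mul (hb i hi), mul_one_div_cancel h2.ne', Real.rpow_one]

lemma sum_rpow_le_rpow_sum {ι : Type*} (s : Finset ι) {a : ι → ℝ} (ha : ∀ i ∈ s, 0 ≤ a i)
    {α : ℝ} (hα : 1 < α) : ∑ i ∈ s, a i ^ α ≤ (∑ i ∈ s, a i) ^ α := by
  have h : ∀ x : ℝ, 0 ≤ x → x ^ α = x * x ^ (α - 1) := fun x hx => by
    conv_rhs => rw [← Real.rpow_one x, ← Real.rpow_mul hx, one_mul]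
    rw [← Real.rpow_add_of_nonneg hx (by norm_num) (by linarith)]
    congr 1; ring
  have hs := Finset.sum_nonneg ha
  rw [h _ hs, Finset.sum_mul]
  refine Finset.sum_le_sum fun i hi => ?_
  rw [h _ (ha i hi)]
  have := ha i hi
  have := Finset.single_le_sum ha hi
  gcongr

lemma abs_rpow_sub_rpow_le {x y θ : ℝ} (hx : 0 ≤ x) (hy : 0 ≤ y) (h0 : 0 ≤ θ) (h1 : θ ≤ 1) :
    |x ^ θ - y ^ θ| ≤ |x - y| ^ θ := by
  wlog h : y ≤ x generalizing x y
  · rw [abs_sub_comm, abs_sub_comm x]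
    exact this hy hx (le_of_not_ge h)
  rw [abs_of_nonneg (sub_nonneg.2 h),
    abs_of_nonneg (sub_nonneg.2 (Real.rpow_le_rpow hy h h0))]
  have := Real.rpow_add_le_add_rpow (sub_nonneg.2 h) hy h0 h1
  rw [sub_add_cancel] at this
  linarith

variable {k : ℕ} {p q u v : Fin k → ℝ} {α : ℝ}

/-- The sum that defines the power divergence of order `α`. -/
noncomputable def powerSum {k : ℕ} (α : ℝ) (p q : Fin k → ℝ) : ℝ := ∑ j, p j ^ α * q j ^ (1 - α)

lemma one_add_mul_powerDiv (h0 : α ≠ 0) (h1 : α ≠ 1) (p q : Fin k → ℝ) :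
    1 + α * (α - 1) * powerDiv α p q = powerSum α p q := by
  have : α - 1 ≠ 0 := sub_ne_zero.2 h1
  rw [powerDiv, if_neg h1, powerSum]
  field_simp
  ring

lemma powerSum_nonneg (hp : ∀ j, 0 ≤ p j) (hq : ∀ j, 0 ≤ q j) : 0 ≤ powerSum α p q :=
  Finset.sum_nonneg fun j _ => mul_nonneg (Real.rpow_nonneg (hp j) _) (Real.rpow_nonneg (hq j) _)

/-- Jensen's inequality for `exp` under the weights `p`. Taking `β = 1 - α` compares with the power
sum, `β = 1` with the null mass of the support. Empty cells are left out because `0 ^ 0 = 1` would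
count them when `β = 1`. -/
lemma exp_neg_mul_klDiv_le (hp : p ∈ stdSimplex ℝ (Fin k)) (hq : ∀ j, 0 < q j) (β : ℝ) :
    Real.exp (-(β * powerDiv 1 p q)) ≤ ∑ j with p j ≠ 0, p j ^ (1 - β) * q j ^ β := by
  have h := convexOn_exp.map_sum_le (t := Finset.univ) (w := p)
    (p := fun j => -(β * Real.log (p j / q j))) (fun j _ => hp.1 j) hp.2 fun _ _ => Set.mem_univ _
  have h1 : ∑ j, p j • -(β * Real.log (p j / q j)) = -(β * powerDiv 1 p q) := by
    rw [powerDiv, if_pos rfl, Finset.mul_sum, ← Finset.sum_neg_distrib]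
    exact Finset.sum_congr rfl fun j _ => by rw [smul_eq_mul]; ring
  rw [h1] at h
  refine h.trans_eq ?_
  rw [Finset.sum_filter]
  refine Finset.sum_congr rfl fun j _ => ?_
  split_ifs with hj
  · have hp0 : 0 < p j := lt_of_le_of_ne (hp.1 j) (Ne.symm hj)
    rw [Real.rpow_def_of_pos hp0, Real.rpow_def_of_pos (hq j), ← Real.exp_add,
      Real.log_div hp0.ne' (hq j).ne', smul_eq_mul]
    conv_lhs => rw [← Real.exp_log hp0]
    rw [Real.log_exp, ← Real.exp_add]
    congr 1; ring
  · simp only [ne_eq, not_not] at hj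
    simp [hj]

lemma exp_mul_klDiv_le_powerSum (hp : p ∈ stdSimplex ℝ (Fin k)) (hq : ∀ j, 0 < q j) (α : ℝ) :
    Real.exp ((α - 1) * powerDiv 1 p q) ≤ powerSum α p q := by
  have h := exp_neg_mul_klDiv_le hp hq (1 - α)
  rw [sub_sub_cancel] at h
  rw [show (α - 1) * powerDiv 1 p q = -((1 - α) * powerDiv 1 p q) by ring]
  exact h.trans (Finset.sum_le_sum_of_subset_of_nonneg (Finset.filter_subset _ _) fun j _ _ =>
    mul_nonneg (Real.rpow_nonneg (hp.1 j) _) (Real.rpow_nonneg (hq j).le _))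

lemma neg_log_le_klDiv (hp : p ∈ stdSimplex ℝ (Fin k)) (hq : ∀ j, 0 < q j) {A : Finset (Fin k)}
    (hA : ∀ j ∉ A, p j = 0) : -Real.log (∑ j ∈ A, q j) ≤ powerDiv 1 p q := by
  have h := exp_neg_mul_klDiv_le hp hq 1
  simp only [sub_self, Real.rpow_zero, one_mul, Real.rpow_one] at h
  have h' : Real.exp (-powerDiv 1 p q) ≤ ∑ j ∈ A, q j := by
    refine h.trans (Finset.sum_le_sum_of_subset_of_nonneg (fun j hj => ?_) fun j _ _ => (hq j).le)
    by_contra hj'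
    exact (Finset.mem_filter.1 hj).2 (hA j hj')
  have := Real.log_le_log (Real.exp_pos _) h'
  rw [Real.log_exp] at this
  linarith

lemma powerSum_le_of_support (hα0 : 0 < α) (hα1 : α < 1) (hp : p ∈ stdSimplex ℝ (Fin k))
    (hq : ∀ j, 0 ≤ q j) {A : Finset (Fin k)} (hA : ∀ j ∉ A, p j = 0) :
    powerSum α p q ≤ (∑ j ∈ A, q j) ^ (1 - α) := by
  have h1 : powerSum α p q = ∑ j ∈ A, p j ^ α * q j ^ (1 - α) := by
    refine (Finset.sum_subset (Finset.subset_univ A) fun j _ hj => ?_).symm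
    rw [hA j hj, Real.zero_rpow hα0.ne', zero_mul]
  have h2 : ∑ j ∈ A, p j = 1 := by
    rw [← hp.2]
    exact Finset.sum_subset (Finset.subset_univ A) fun j _ hj => hA j hj
  have h := sum_rpow_mul_rpow_le A (fun j _ => hp.1 j) (fun j _ => hq j) hα0 hα1
  rwa [← h1, h2, Real.one_rpow, one_mul] at h

/-- Hölder's inequality for `p^α₂ q^(1-α₂) = (p^α₁ q^(1-α₁))^θ p^(1-θ)` with `θ = (1-α₂)/(1-α₁)`. In
the limit it shows that `Δ₁` is an admissible level whenever `Δ₂` is. -/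
lemma powerSum_rpow_le (hp : p ∈ stdSimplex ℝ (Fin k)) (hq : ∀ j, 0 < q j) {α₁ α₂ : ℝ}
    (h0 : 0 < α₁) (h : α₁ < α₂) (h1 : α₂ < 1) :
    powerSum α₂ p q ≤ powerSum α₁ p q ^ ((1 - α₂) / (1 - α₁)) := by
  have ha : 0 < 1 - α₁ := by linarith
  have hθ : (1 - α₂) / (1 - α₁) < 1 := by rw [div_lt_one ha]; linarith
  have hθ0 : 0 < (1 - α₂) / (1 - α₁) := div_pos (by linarith) ha
  have hh := sum_rpow_mul_rpow_le Finset.univ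
    (a := fun j => p j ^ α₁ * q j ^ (1 - α₁)) (b := p)
    (fun j _ => mul_nonneg (Real.rpow_nonneg (hp.1 j) _) (Real.rpow_nonneg (hq j).le _))
    (fun j _ => hp.1 j) hθ0 hθ
  rw [hp.2, Real.one_rpow, mul_one] at hh
  refine le_trans (Finset.sum_le_sum fun j _ => le_of_eq ?_) hh
  have hpj := hp.1 j
  rw [Real.mul_rpow (Real.rpow_nonneg hpj _) (Real.rpow_nonneg (hq j).le _),
    ← Real.rpow_mul hpj, ← Real.rpow_mul (hq j).le, mul_div_cancel₀ _ ha.ne', mul_right_comm,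
    ← Real.rpow_add_of_nonneg hpj (by positivity) (by linarith)]
  congr 2
  field_simp
  ring

/-- The convex function whose mean is the excess of the power sum over `1`. -/
noncomputable def powerExcess (α r : ℝ) : ℝ := r ^ α - 1 - α * (r - 1)

lemma powerExcess_nonneg (hα : 1 ≤ α) {r : ℝ} (hr : 0 ≤ r) : 0 ≤ powerExcess α r := by
  have := one_add_mul_self_le_rpow_one_add (s := r - 1) (by linarith) hα
  rw [add_sub_cancel] at this
  unfold powerExcess
  linarith

lemma rpow_mul_rpow_one_sub {x y : ℝ} (hx : 0 ≤ x) (hy : 0 < y) (α : ℝ) :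
    x ^ α * y ^ (1 - α) = y * (x / y) ^ α := by
  rw [Real.div_rpow hx hy.le, Real.rpow_sub hy, Real.rpow_one]
  ring

/-- Subtracting the linear part, whose mean is zero, makes every summand nonnegative for `α ≥ 1`, so
that single cells can be isolated. -/
lemma powerSum_sub_one (hp : p ∈ stdSimplex ℝ (Fin k)) (hq : ∀ j, 0 < q j)
    (hq1 : ∑ j, q j = 1) (α : ℝ) :
    powerSum α p q - 1 = ∑ j, q j * powerExcess α (p j / q j) := by
  have : ∀ j, q j * powerExcess α (p j / q j) =
      p j ^ α * q j ^ (1 - α) - q j - α * (p j - q j) := by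
    intro j
    have := (hq j).ne'
    rw [rpow_mul_rpow_one_sub (hp.1 j) (hq j), powerExcess]
    field_simp
  simp only [this, Finset.sum_sub_distrib, ← Finset.mul_sum, hp.2, hq1, powerSum]
  ring

lemma powerDiv_nonneg (hα : 0 < α) (hp : p ∈ stdSimplex ℝ (Fin k)) (hq : ∀ j, 0 < q j)
    (hq1 : ∑ j, q j = 1) : 0 ≤ powerDiv α p q := by
  rcases lt_trichotomy α 1 with h | h | h
  · have h1 := one_add_mul_powerDiv hα.ne' h.ne p q
    have h2 := powerSum_le_of_support hα h hp (fun j => (hq j).le) (A := Finset.univ) (by simp)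
    rw [hq1, Real.one_rpow] at h2
    by_contra! h3
    nlinarith [mul_pos hα (sub_pos.2 h)]
  · subst h
    have := neg_log_le_klDiv hp hq (A := Finset.univ) (by simp)
    simpa [hq1] using this
  · have h1 := one_add_mul_powerDiv hα.ne' h.ne' p q
    have h2 : 0 ≤ powerSum α p q - 1 := by
      rw [powerSum_sub_one hp hq hq1]
      exact Finset.sum_nonneg fun j _ =>
        mul_nonneg (hq j).le (powerExcess_nonneg h.le (div_nonneg (hp.1 j) (hq j).le))
    by_contra! h3
    nlinarith [mul_pos hα (sub_pos.2 h)]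

/-- Cell by cell this is `log y ≤ y - 1` at `y = (p j / q j) ^ (α - 1)`. -/
lemma klDiv_le_mul_powerDiv (hα : 1 < α) (hp : p ∈ stdSimplex ℝ (Fin k)) (hq : ∀ j, 0 < q j) :
    powerDiv 1 p q ≤ α * powerDiv α p q := by
  have ha : 0 < α - 1 := by linarith
  have h1 := one_add_mul_powerDiv (by linarith) hα.ne' p q
  have h2 : (α - 1) * powerDiv 1 p q ≤ powerSum α p q - 1 := by
    rw [show powerSum α p q - 1 = powerSum α p q - ∑ j, p j by rw [hp.2], powerDiv, if_pos rfl,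
      Finset.mul_sum, powerSum, ← Finset.sum_sub_distrib]
    refine Finset.sum_le_sum fun j _ => ?_
    rcases (hp.1 j).eq_or_lt with h | h
    · rw [← h, Real.zero_rpow (by linarith)]; simp
    · have hr : 0 < p j / q j := div_pos h (hq j)
      have h3 := Real.log_le_rpow_div hr.le ha
      have h4 := Real.log_le_sub_one_of_pos (Real.rpow_pos_of_pos hr (α - 1))
      rw [Real.log_rpow hr] at h4
      have h5 : p j ^ α * q j ^ (1 - α) = p j * (p j / q j) ^ (α - 1) := by
        rw [rpow_mul_rpow_one_sub h.le (hq j), Real.rpow_sub_one hr.ne']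
        have := (hq j).ne'
        field_simp
      rw [h5]
      nlinarith
  have h3 : (α - 1) * powerDiv 1 p q ≤ (α - 1) * (α * powerDiv α p q) := by linarith
  exact le_of_mul_le_mul_left h3 ha

/-- The convex function whose mean is the information divergence. -/
noncomputable def klExcess (r : ℝ) : ℝ := r * Real.log r - r + 1

/-- The left side is the tangent at `a` of the convex function `klExcess`. -/
lemma le_klExcess {r a : ℝ} (hr : 0 ≤ r) (ha : 0 < a) : r * Real.log a - a + 1 ≤ klExcess r := by
  unfold klExcess
  rcases hr.eq_or_lt with rfl | hr
  · simp; linarith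
  · have h := Real.log_le_sub_one_of_pos (div_pos ha hr)
    rw [Real.log_div ha.ne' hr.ne'] at h
    have h' := mul_le_mul_of_nonneg_left h hr.le
    have : r * (a / r - 1) = a - r := by field_simp
    nlinarith

lemma klExcess_nonneg {r : ℝ} (hr : 0 ≤ r) : 0 ≤ klExcess r := by
  simpa using le_klExcess hr one_pos

lemma klDiv_eq_sum_klExcess (hu : ∑ j, u j = 1) (hv : ∑ j, v j = 1)
    (hac : ∀ j, v j = 0 → u j = 0) : powerDiv 1 u v = ∑ j, v j * klExcess (u j / v j) := by
  have : ∀ j, v j * klExcess (u j / v j) = u j * Real.log (u j / v j) - u j + v j := by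
    intro j
    rcases eq_or_ne (v j) 0 with hj | hj
    · simp [hj, hac j hj]
    · unfold klExcess; field_simp
  simp only [this, Finset.sum_add_distrib, Finset.sum_sub_distrib, hu, hv, powerDiv, if_true]
  ring

lemma klDiv_nonneg (hu : u ∈ stdSimplex ℝ (Fin k)) (hv : v ∈ stdSimplex ℝ (Fin k))
    (hac : ∀ j, v j = 0 → u j = 0) : 0 ≤ powerDiv 1 u v := by
  rw [klDiv_eq_sum_klExcess hu.2 hv.2 hac]
  exact Finset.sum_nonneg fun j _ =>
    mul_nonneg (hv.1 j) (klExcess_nonneg (div_nonneg (hu.1 j) (hv.1 j)))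

/-- The tangents at `1 + η` and `1 - η` provide the bounds on the two sides of 1; the constant is
the smaller of the two resulting ones. -/
lemma exists_mul_max_le_klExcess {η : ℝ} (h0 : 0 < η) (h1 : η < 1) :
    ∃ c : ℝ, 0 < c ∧ ∀ r : ℝ, 0 ≤ r → η < |r - 1| → c * max r 1 ≤ klExcess r := by
  have hc1 : 0 < Real.log (1 + η) - η / (1 + η) := by
    have h := Real.log_lt_sub_one_of_pos (x := 1 / (1 + η)) (by positivity)
      (by rw [ne_eq, div_eq_one_iff_eq (by positivity)]; linarith)
    rw [one_div, Real.log_inv] at h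
    have : η / (1 + η) = 1 - (1 + η)⁻¹ := by field_simp; ring
    linarith
  have hc2 : 0 < (1 - η) * Real.log (1 - η) + η := by
    have h2 : 0 < 1 - η := by linarith
    have h := Real.log_lt_sub_one_of_pos (x := 1 / (1 - η)) (by positivity)
      (by rw [ne_eq, div_eq_one_iff_eq (by positivity)]; linarith)
    rw [one_div, Real.log_inv] at h
    have h3 := mul_lt_mul_of_pos_left h h2
    have : (1 - η) * ((1 - η)⁻¹ - 1) = η := by field_simp; ring
    nlinarith
  refine ⟨min (Real.log (1 + η) - η / (1 + η)) ((1 - η) * Real.log (1 - η) + η),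
    lt_min hc1 hc2, fun r hr hη => ?_⟩
  rcases le_total 1 r with h | h
  · rw [abs_of_nonneg (by linarith)] at hη
    rw [max_eq_left h]
    refine (mul_le_mul_of_nonneg_right (min_le_left _ _) hr).trans ?_
    refine le_trans ?_ (le_klExcess hr (a := 1 + η) (by linarith))
    have : η ≤ r * (η / (1 + η)) := by
      rw [mul_div_assoc', le_div_iff₀ (by linarith)]
      nlinarith
    nlinarith
  · rw [abs_of_nonpos (by linarith)] at hη
    rw [max_eq_right h, mul_one]
    refine (min_le_right _ _).trans ?_
    refine le_trans ?_ (le_klExcess hr (a := 1 - η) (by linarith))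
    have := Real.log_nonpos (x := 1 - η) (by linarith) (by linarith)
    nlinarith

/-- Cells with a large relative deviation carry little mass if the information divergence is
small. -/
lemma exists_sum_max_le_klDiv {η : ℝ} (h0 : 0 < η) (h1 : η < 1) :
    ∃ c : ℝ, 0 < c ∧ ∀ (k : ℕ) (u v : Fin k → ℝ), u ∈ stdSimplex ℝ (Fin k) →
      v ∈ stdSimplex ℝ (Fin k) → (∀ j, v j = 0 → u j = 0) →
      ∑ j with η * v j < |u j - v j|, max (u j) (v j) ≤ powerDiv 1 u v / c := by
  obtain ⟨c, hc, h⟩ := exists_mul_max_le_klExcess h0 h1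
  refine ⟨c, hc, fun k u v hu hv hac => ?_⟩
  rw [le_div_iff₀ hc]
  rw [klDiv_eq_sum_klExcess hu.2 hv.2 hac, Finset.sum_mul]
  refine le_trans (Finset.sum_le_sum fun j hj => ?_)
    (Finset.sum_le_sum_of_subset_of_nonneg (Finset.filter_subset _ _) fun j _ _ =>
      mul_nonneg (hv.1 j) (klExcess_nonneg (div_nonneg (hu.1 j) (hv.1 j))))
  have hj := (Finset.mem_filter.1 hj).2
  have hv0 : 0 < v j := by
    refine lt_of_le_of_ne (hv.1 j) fun h' => ?_
    rw [hac j h'.symm, ← h'] at hj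
    simp at hj
  have e : |u j - v j| = v j * |u j / v j - 1| := by
    rw [← abs_of_pos hv0, ← abs_mul, abs_of_pos hv0]
    congr 1; field_simp
  have := h (u j / v j) (div_nonneg (hu.1 j) (hv.1 j)) (by
    rw [e, mul_comm] at hj
    exact lt_of_mul_lt_mul_left hj hv0.le)
  calc max (u j) (v j) * c = v j * (c * max (u j / v j) 1) := by
        rw [mul_comm c, ← mul_assoc, mul_max_of_nonneg _ _ hv0.le, mul_div_cancel₀ _ hv0.ne',
          mul_one]
    _ ≤ _ := by gcongr

/-- With `u` empirical and `v` the true distribution, this splits the divergence from `q` into a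
small part and a mean of independent terms. -/
lemma klDiv_eq_add (hu : ∀ j, v j = 0 → u j = 0) (hq : ∀ j, 0 < q j) :
    powerDiv 1 u q = powerDiv 1 u v + ∑ j, u j * Real.log (v j / q j) := by
  simp only [powerDiv, if_true, ← Finset.sum_add_distrib]
  refine Finset.sum_congr rfl fun j _ => ?_
  rcases eq_or_ne (u j) 0 with h | h
  · simp [h]
  · have hv : v j ≠ 0 := fun hv => h (hu j hv)
    rw [Real.log_div h (hq j).ne', Real.log_div h hv, Real.log_div hv (hq j).ne']
    ring

end Inequalities

end PowerDivergence

namespace PowerDivergence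

/-! ### Bahadur functions of order at most one. -/

section LowOrder

variable {k : ℕ → ℕ} {P Q : (n : ℕ) → Fin (k n) → ℝ}

lemma RegularNull.pos (h : RegularNull k Q) {n : ℕ} (hn : 1 ≤ n) (j : Fin (k n)) : 0 < Q n j := by
  obtain ⟨ρ, hρ, h⟩ := h.lower_bound
  exact lt_of_le_of_lt (by positivity) (h n hn j)

lemma tendsto_mul_log_succ {a : ℕ → ℝ} (ha : ∀ n, 0 ≤ a n)
    (h : Tendsto (fun n : ℕ => a n * Real.log n / n) atTop (𝓝 0)) :
    Tendsto (fun n : ℕ => a n * Real.log (n + 1) / n) atTop (𝓝 0) := by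
  have h2 := h.const_mul 2
  rw [mul_zero] at h2
  refine squeeze_zero' (Eventually.of_forall fun n => ?_) ?_ h2
  · have := ha n
    have : 0 ≤ Real.log (n + 1) := Real.log_nonneg (by linarith [n.cast_nonneg (α := ℝ)])
    positivity
  · filter_upwards [eventually_ge_atTop 2] with n hn
    have hn' : (2 : ℝ) ≤ n := by exact_mod_cast hn
    have h1 : Real.log (n + 1) ≤ 2 * Real.log n := by
      rw [← Real.log_rpow (by linarith)]
      refine Real.log_le_log (by linarith) ?_
      norm_cast
      nlinarith
    have := ha n
    rw [← mul_div_assoc]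
    refine div_le_div_of_nonneg_right ?_ n.cast_nonneg
    nlinarith

lemma errorProb_nonneg (k : ℕ → ℕ) (Q : (n : ℕ) → Fin (k n) → ℝ) (α : ℝ) (n : ℕ) (x : ℝ) :
    0 ≤ errorProb k Q α n x := measureReal_nonneg

/-- Turns upper bounds for the error probability into a deterministic problem: bounding the
information divergence from below on `{D_α > x}`. -/
lemma errorProb_le {n : ℕ} (hn : 1 ≤ n) (hQ : Q n ∈ stdSimplex ℝ (Fin (k n))) {α x b : ℝ}
    (h : ∀ p ∈ stdSimplex ℝ (Fin (k n)), x < powerDiv α p (Q n) → b ≤ powerDiv 1 p (Q n)) :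
    errorProb k Q α n x ≤ (n + 1 : ℝ) ^ k n * Real.exp (-(n * b)) := by
  have := isProbabilityMeasure_sampleLaw hQ n
  refine le_trans (measureReal_mono ?_) (sampleLaw_klDiv_ge_le hn hQ b)
  exact fun ω hω => h _ (empirical_mem hn ω) hω

lemma neg_log_errorProb_ge {n : ℕ} (hn : 1 ≤ n) (hQ : Q n ∈ stdSimplex ℝ (Fin (k n)))
    {α x b : ℝ} (h0 : 0 < errorProb k Q α n x)
    (h : ∀ p ∈ stdSimplex ℝ (Fin (k n)), x < powerDiv α p (Q n) → b ≤ powerDiv 1 p (Q n)) :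
    n * b - k n * Real.log (n + 1) ≤ -Real.log (errorProb k Q α n x) := by
  have h1 := Real.log_le_log h0 (errorProb_le hn hQ h)
  rw [Real.log_mul (by positivity) (Real.exp_pos _).ne', Real.log_exp, Real.log_pow] at h1
  linarith

/-- A set of largest cardinality among those of mass below `s`: adding any further cell must
overshoot `s`, and a cell has mass at most `ε`. -/
lemma exists_sum_mem_Ico {K : ℕ} {q : Fin K → ℝ} (hq : q ∈ stdSimplex ℝ (Fin K)) {ε s : ℝ}
    (hε : ∀ j, q j ≤ ε) (h0 : 0 < s) (h1 : s ≤ 1) :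
    ∃ A : Finset (Fin K), s - ε ≤ ∑ j ∈ A, q j ∧ ∑ j ∈ A, q j < s := by
  classical
  obtain ⟨A, hA, hmax⟩ := Finset.exists_max_image
    (Finset.univ.filter fun A : Finset (Fin K) => ∑ j ∈ A, q j < s) Finset.card
    ⟨∅, by simpa using h0⟩
  have hAs := (Finset.mem_filter.1 hA).2
  refine ⟨A, ?_, hAs⟩
  have : ∃ j, j ∉ A := by
    by_contra! h
    rw [(Finset.eq_univ_iff_forall).2 h, hq.2] at hAs
    linarith
  obtain ⟨j, hj⟩ := this
  by_contra! hlt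
  have h2 := hmax (insert j A) (by
    rw [Finset.mem_filter, Finset.sum_insert hj]
    exact ⟨Finset.mem_univ _, by linarith [hε j]⟩)
  rw [Finset.card_insert_of_notMem hj] at h2
  omega

/-- The Bahadur function of order `α ≤ 1`: the Rényi divergence of order `α` that corresponds to
the value `x` of the power divergence. -/
noncomputable def renyiLevel (α x : ℝ) : ℝ :=
  if α = 1 then x else Real.log (1 + α * (α - 1) * x) / (α - 1)

lemma renyiLevel_pos {α x : ℝ} (h0 : 0 < α) (h1 : α ≤ 1) (hx : x ∈ levels α) :
    0 < renyiLevel α x := by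
  unfold renyiLevel
  split_ifs with h
  · exact hx.1
  · have h2 : α < 1 := lt_of_le_of_ne h1 h
    refine div_pos_of_neg_of_neg (Real.log_neg hx.2 ?_) (by linarith)
    nlinarith [mul_pos (mul_pos h0 (sub_pos.2 h2)) hx.1]

lemma renyiLevel_le_klDiv {K : ℕ} {p q : Fin K → ℝ} {α x : ℝ} (h0 : 0 < α) (h1 : α ≤ 1)
    (hx : x ∈ levels α) (hp : p ∈ stdSimplex ℝ (Fin K)) (hq : ∀ j, 0 < q j)
    (h : x < powerDiv α p q) : renyiLevel α x ≤ powerDiv 1 p q := by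
  unfold renyiLevel
  split_ifs with h2
  · rw [← h2]; exact h.le
  · have h3 : α < 1 := lt_of_le_of_ne h1 h2
    have h4 := exp_mul_klDiv_le_powerSum hp hq α
    rw [← one_add_mul_powerDiv h0.ne' h2] at h4
    have h5 : Real.exp ((α - 1) * powerDiv 1 p q) ≤ 1 + α * (α - 1) * x := by
      nlinarith [mul_pos (mul_pos h0 (sub_pos.2 h3)) (sub_pos.2 h)]
    have h6 := (Real.le_log_iff_exp_le hx.2).2 h5
    rw [div_le_iff_of_neg (by linarith)]
    linarith

/-- By Hölder's inequality (Jensen's if `α = 1`), concentration on a set of small null mass forces a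
large divergence; the threshold is exact because `exp(-renyiLevel α x) ^ (1-α) = 1 + α(α-1)x` for `α
< 1`. -/
lemma lt_powerDiv_of_support {K : ℕ} {p q : Fin K → ℝ} {α x : ℝ} (h0 : 0 < α) (h1 : α ≤ 1)
    (hx : x ∈ levels α) (hp : p ∈ stdSimplex ℝ (Fin K)) (hq : ∀ j, 0 < q j)
    {A : Finset (Fin K)} (hA : ∀ j ∉ A, p j = 0)
    (h : ∑ j ∈ A, q j < Real.exp (-renyiLevel α x)) : x < powerDiv α p q := by
  have hne : A.Nonempty := by
    by_contra! hne
    have := hp.2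
    rw [Finset.sum_eq_zero fun j _ => hA j (by simp [hne])] at this
    norm_num at this
  have hpos : 0 < ∑ j ∈ A, q j := Finset.sum_pos (fun j _ => hq j) hne
  rcases eq_or_ne α 1 with rfl | h2
  · have h3 := neg_log_le_klDiv hp hq hA
    rw [renyiLevel, if_pos rfl] at h
    have h4 := Real.log_lt_log hpos h
    rw [Real.log_exp] at h4
    linarith
  · have h3 : α < 1 := lt_of_le_of_ne h1 h2
    have h4 := powerSum_le_of_support h0 h3 hp (fun j => (hq j).le) hA
    have h5 := Real.rpow_lt_rpow hpos.le h (sub_pos.2 h3)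
    rw [← Real.exp_mul, renyiLevel, if_neg h2,
      show -(Real.log (1 + α * (α - 1) * x) / (α - 1)) * (1 - α) =
        Real.log (1 + α * (α - 1) * x) by
          have : α - 1 ≠ 0 := sub_ne_zero.2 h2
          field_simp; ring, Real.exp_log hx.2] at h5
    have h6 := one_add_mul_powerDiv h0.ne' h2 p q
    have h7 := mul_pos h0 (sub_pos.2 h3)
    by_contra! h8
    nlinarith [mul_le_mul_of_nonneg_left h8 h7.le]

lemma isBahadurFunction_renyiLevel (hM : CellModel k P Q) (hR : RegularNull k Q)
    (hk : Tendsto (fun n : ℕ => (k n : ℝ) * Real.log n / n) atTop (𝓝 0)) {α : ℝ} (h0 : 0 < α)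
    (h1 : α ≤ 1) : IsBahadurFunction k Q α (renyiLevel α) fun _ => 1 where
  continuousOn := by
    unfold renyiLevel
    split_ifs with h
    · exact continuousOn_id
    · refine ContinuousOn.div_const (ContinuousOn.log (by fun_prop) fun x hx => hx.2.ne') _
  pos x hx := renyiLevel_pos h0 h1 hx
  generator_pos := by simp
  tendsto x hx := by
    set g := renyiLevel α x with hg
    have hgpos : 0 < g := renyiLevel_pos h0 h1 hx
    set s := Real.exp (-g)
    have hs : 0 < s := Real.exp_pos _
    have hs1 : s ≤ 1 := Real.exp_le_one_iff.2 (by linarith)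
    -- The event that all observations lie in a set `A` of null mass in `[s - max, s)` has
    -- probability `Q(A)^n` and forces the statistic above `x`.
    have hlow : ∀ᶠ n : ℕ in atTop, (s - ⨆ j, Q n j) ^ n ≤ errorProb k Q α n x := by
      filter_upwards [eventually_ge_atTop 1, hR.max_tendsto.eventually (gt_mem_nhds hs)]
        with n hn hsup
      have hQ := hM.null_mem n hn
      have := isProbabilityMeasure_sampleLaw hQ n
      obtain ⟨A, hA1, hA2⟩ := exists_sum_mem_Ico hQ
        (fun j => le_ciSup (Set.finite_range (Q n)).bddAbove j) hs hs1
      have h2 := sampleLaw_real_pi (n := n) hQ fun _ => A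
      rw [Finset.prod_const, Finset.card_univ, Fintype.card_fin] at h2
      calc _ ≤ (∑ j ∈ A, Q n j) ^ n := by
            gcongr
        _ = _ := h2.symm
        _ ≤ _ := by
            refine measureReal_mono fun ω hω => ?_
            refine lt_powerDiv_of_support h0 h1 hx (empirical_mem hn ω) (hR.pos hn) (A := A) ?_ hA2
            exact fun j hj => empirical_eq_zero fun i hi => hj (hi ▸ hω i)
    have hl1 : Tendsto (fun n : ℕ => g - k n * Real.log (n + 1) / n) atTop (𝓝 g) := by
      simpa using (tendsto_mul_log_succ (fun n => (k n).cast_nonneg) hk).const_sub g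
    have hl2 : Tendsto (fun n : ℕ => -Real.log (s - ⨆ j, Q n j)) atTop (𝓝 g) := by
      have := ((hR.max_tendsto.const_sub s).log (by simpa using hs.ne')).neg
      simpa [s] using this
    have hpos : ∀ᶠ n : ℕ in atTop, 0 < s - ⨆ j, Q n j := by
      filter_upwards [hR.max_tendsto.eventually (gt_mem_nhds hs)] with n hn
      linarith
    refine tendsto_of_tendsto_of_tendsto_of_le_of_le' hl1 hl2 ?_ ?_
    · filter_upwards [hlow, hpos, eventually_ge_atTop 1] with n hn hp hn1
      have hn0 : (0 : ℝ) < n := by exact_mod_cast hn1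
      have h3 := neg_log_errorProb_ge hn1 (hM.null_mem n hn1) (lt_of_lt_of_le (pow_pos hp n) hn)
        fun p hp => renyiLevel_le_klDiv h0 h1 hx hp (hR.pos hn1)
      have h4 := div_le_div_of_nonneg_right h3 hn0.le
      calc _ = (n * g - k n * Real.log (n + 1)) / n := by field_simp
        _ ≤ _ := h4
        _ = _ := by ring
    · filter_upwards [hlow, hpos, eventually_ge_atTop 1] with n hn hp hn1
      have hn0 : (0 : ℝ) < n := by exact_mod_cast hn1
      have h3 := Real.log_le_log (pow_pos hp n) hn
      rw [Real.log_pow] at h3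
      have h4 := div_le_div_of_nonneg_right h3 hn0.le
      rw [mul_div_cancel_left₀ _ hn0.ne'] at h4
      calc _ = -(Real.log (errorProb k Q α n x) / n) := by ring
        _ ≤ _ := by linarith

end LowOrder

end PowerDivergence

namespace PowerDivergence

/-! ### The minimal information divergence for orders above one. -/

section HighOrder

/-- Both functions vanish to second order at 1, and the quotient of their second derivatives is
`α(α-1) r^(α-1)`, at most the stated constant on `(0, T]`. The proof shows that the difference
decreases before 1 and increases after it. -/
lemma powerExcess_le_mul_klExcess {α T r : ℝ} (hα : 1 < α) (hT : 1 ≤ T) (h0 : 0 ≤ r)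
    (hr : r ≤ T) : powerExcess α r ≤ α * (α - 1) * T ^ (α - 1) * klExcess r := by
  set C := α * (α - 1) * T ^ (α - 1) with hC
  have ha : 0 < α - 1 := by linarith
  have hTp : 1 ≤ T ^ (α - 1) := Real.one_le_rpow hT ha.le
  have hα0 : 0 < α * (α - 1) := by nlinarith
  let f : ℝ → ℝ := fun x => C * klExcess x - powerExcess α x
  have hcont : Continuous f := by
    have h1 : Continuous klExcess := by
      unfold klExcess
      exact (Real.continuous_mul_log.sub continuous_id).add continuous_const
    have h2 : Continuous (powerExcess α) := by
      unfold powerExcess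
      have := Real.continuous_rpow_const (q := α) (by linarith)
      fun_prop
    fun_prop
  have hder : ∀ x : ℝ, 0 < x →
      HasDerivAt f (C * Real.log x - α * (x ^ (α - 1) - 1)) x := by
    intro x hx
    have h1 : HasDerivAt klExcess (Real.log x + 1 - 1) x :=
      ((Real.hasDerivAt_mul_log hx.ne').sub (hasDerivAt_id x)).add_const 1
    have h2 : HasDerivAt (powerExcess α) (α * x ^ (α - 1) - α * 1) x :=
      ((Real.hasDerivAt_rpow_const (Or.inl hx.ne')).sub_const 1).sub
        (((hasDerivAt_id x).sub_const 1).const_mul α)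
    exact ((h1.const_mul C).sub h2).congr_deriv (by ring)
  have hf1 : f 1 = 0 := by simp [f, klExcess, powerExcess]
  suffices h : 0 ≤ f r by simpa [f] using h
  rw [← hf1]
  rcases le_total r 1 with h | h
  · have hanti : AntitoneOn f (Set.Icc 0 1) := by
      refine antitoneOn_of_deriv_nonpos (convex_Icc 0 1) hcont.continuousOn ?_ ?_
      · rw [interior_Icc]
        exact fun x hx => (hder x hx.1).differentiableAt.differentiableWithinAt
      · rw [interior_Icc]
        intro x hx
        rw [(hder x hx.1).deriv]
        have h1 := Real.log_le_sub_one_of_pos (Real.rpow_pos_of_pos hx.1 (α - 1))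
        rw [Real.log_rpow hx.1] at h1
        have h2 := Real.log_neg hx.1 hx.2
        have h3 : C * Real.log x ≤ α * (α - 1) * Real.log x := by
          refine mul_le_mul_of_nonpos_right ?_ h2.le
          nlinarith
        nlinarith
    exact hanti ⟨h0, h⟩ ⟨zero_le_one, le_rfl⟩ h
  · have hmono : MonotoneOn f (Set.Icc 1 T) := by
      refine monotoneOn_of_deriv_nonneg (convex_Icc 1 T) hcont.continuousOn ?_ ?_
      · rw [interior_Icc]
        exact fun x hx =>
          (hder x (by linarith [hx.1])).differentiableAt.differentiableWithinAt
      · rw [interior_Icc]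
        intro x hx
        have hx0 : 0 < x := by linarith [hx.1]
        rw [(hder x hx0).deriv]
        have hy := Real.rpow_pos_of_pos hx0 (α - 1)
        have h1 := Real.log_le_sub_one_of_pos (inv_pos.2 hy)
        -- With `y = x^(α-1)`, the logarithmic inequality at `1/y` becomes `y - 1 ≤ y log y`.
        rw [Real.log_inv, Real.log_rpow hx0] at h1
        have h2 := Real.log_pos hx.1
        have h3 := mul_le_mul_of_nonneg_left h1 hy.le
        rw [mul_sub, mul_inv_cancel₀ hy.ne'] at h3
        have h4 : x ^ (α - 1) ≤ T ^ (α - 1) := Real.rpow_le_rpow hx0.le hx.2.le ha.le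
        have h5 : x ^ (α - 1) * ((α - 1) * Real.log x) ≤ T ^ (α - 1) * ((α - 1) * Real.log x) := by
          gcongr
        have h6 : α * (x ^ (α - 1) - 1) ≤ α * (T ^ (α - 1) * ((α - 1) * Real.log x)) := by
          gcongr
          linarith
        have : C * Real.log x = α * (T ^ (α - 1) * ((α - 1) * Real.log x)) := by rw [hC]; ring
        linarith
    exact hmono ⟨le_rfl, hT⟩ ⟨h, hr⟩ h

lemma mul_log_le_klExcess {T r : ℝ} (hT : 1 < T) (hr : T ≤ r) :
    (1 - 1 / Real.log T) * (r * Real.log r) ≤ klExcess r := by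
  have h1 := Real.log_pos hT
  have h2 := Real.log_le_log (by linarith) hr
  have : r ≤ 1 / Real.log T * (r * Real.log r) := by
    rw [one_div_mul_eq_div, le_div_iff₀ h1]
    have : 0 < r := by linarith
    gcongr
  unfold klExcess
  linarith

/-- Subject to a lower bound for the sum of powers, the sum of the `r log r` is smallest if there
is just one term. -/
lemma mul_log_le_sum {ι : Type*} (s : Finset ι) {r : ι → ℝ} {α T R : ℝ} (hα : 1 < α)
    (hT : Real.exp (α - 1)⁻¹ ≤ T) (hr : ∀ i ∈ s, T ≤ r i) (hR : T ≤ R)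
    (h : R ^ α ≤ ∑ i ∈ s, r i ^ α) : R * Real.log R ≤ ∑ i ∈ s, r i * Real.log (r i) := by
  have ha : 0 < α - 1 := by linarith
  have hT1 : 1 < T := lt_of_lt_of_le (Real.one_lt_exp_iff.2 (inv_pos.2 ha)) hT
  have hpow : ∀ y : ℝ, T ≤ y → y * Real.log y = y ^ α * (Real.log y / y ^ (α - 1)) := by
    intro y hy
    have hy0 : 0 < y := by linarith
    rw [Real.rpow_sub_one hy0.ne']
    have := (Real.rpow_pos_of_pos hy0 α).ne'
    field_simp
  have hlogR : 0 ≤ Real.log R := Real.log_nonneg (by linarith)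
  -- Beyond `exp(1/(α-1))` the function `log y / y^(α-1)` decreases, so terms up to `R` yield at
  -- least as much `r log r` per unit of `r^α` as `R` does. A term above `R` suffices alone.
  by_cases hall : ∀ i ∈ s, r i ≤ R
  · rw [hpow R hR]
    calc _ ≤ (∑ i ∈ s, r i ^ α) * (Real.log R / R ^ (α - 1)) := by
          have : 0 ≤ R := by linarith
          gcongr
      _ ≤ _ := by
          rw [Finset.sum_mul]
          refine Finset.sum_le_sum fun i hi => ?_
          rw [hpow _ (hr i hi)]
          refine mul_le_mul_of_nonneg_left ?_
            (Real.rpow_nonneg (by linarith [hr i hi]) _)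
          exact Real.log_div_self_rpow_antitoneOn ha (hT.trans (hr i hi)) (hT.trans hR) (hall i hi)
  · push Not at hall
    obtain ⟨i, hi, hRi⟩ := hall
    refine le_trans ?_ (Finset.single_le_sum (f := fun i => r i * Real.log (r i)) (fun j hj => ?_)
      hi)
    · have : 0 < R := by linarith
      gcongr
      linarith
    · have := hr j hj
      exact mul_nonneg (by linarith) (Real.log_nonneg (by linarith))

/-- A power divergence of order `α > 1` from the uniform distribution that stays away from zero
forces the information divergence to exceed a quantity of the order `log K / K ^ (1 - 1 / α)`. -/
lemma eventually_le_klDiv_uniform {α δ g : ℝ} (hα : 1 < α) (hδ : 0 < δ)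
    (hg : g < δ ^ (1 / α) / α) :
    ∀ᶠ K : ℕ in atTop, ∀ p ∈ stdSimplex ℝ (Fin K), ∀ q : Fin K → ℝ, (∀ j, q j = 1 / K) →
      1 + δ ≤ powerSum α p q →
      g * (Real.log K / (K : ℝ) ^ (1 - 1 / α)) ≤ powerDiv 1 p q := by
  have hα0 : 0 < α := by linarith
  have hβ : 0 < 1 - 1 / α := by
    rw [sub_pos, div_lt_one hα0]; exact hα
  -- The slack `δ - δ'` absorbs the cells with ratio below `T`; a large `T` makes the loss factor `1
  -- - 1/log T` harmless.
  obtain ⟨δ', hδ'0, hδ'δ, hg'⟩ : ∃ δ', 0 < δ' ∧ δ' < δ ∧ g < δ' ^ (1 / α) / α := by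
    have hc : Tendsto (fun y : ℝ => y ^ (1 / α) / α) (𝓝[<] δ) (𝓝 (δ ^ (1 / α) / α)) :=
      ((Real.continuousAt_rpow_const _ _ (Or.inl hδ.ne')).tendsto.div_const α).mono_left
        nhdsWithin_le_nhds
    obtain ⟨y, h1, h2⟩ := ((hc.eventually (lt_mem_nhds hg)).and (Ioo_mem_nhdsLT hδ)).exists
    exact ⟨y, h2.1, h2.2, h1⟩
  obtain ⟨T, hT, hTg⟩ : ∃ T, Real.exp (α - 1)⁻¹ ≤ T ∧
      g < (1 - 1 / Real.log T) * (δ' ^ (1 / α) / α) := by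
    have hc : Tendsto (fun T : ℝ => (1 - 1 / Real.log T) * (δ' ^ (1 / α) / α)) atTop
        (𝓝 ((1 - 0) * (δ' ^ (1 / α) / α))) := by
      simp only [one_div]
      exact (Real.tendsto_log_atTop.inv_tendsto_atTop.const_sub 1).mul_const _
    rw [sub_zero, one_mul] at hc
    obtain ⟨T, h1, h2⟩ := ((hc.eventually (lt_mem_nhds hg')).and (eventually_ge_atTop _)).exists
    exact ⟨T, h2, h1⟩
  have ha : 0 < α - 1 := by linarith
  have hT1 : 1 < T := lt_of_lt_of_le (Real.one_lt_exp_iff.2 (inv_pos.2 ha)) hT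
  set C := α * (α - 1) * T ^ (α - 1) with hC
  have hC0 : 0 ≤ C := by positivity
  have hlogK : Tendsto (fun K : ℕ => Real.log K) atTop atTop :=
    Real.tendsto_log_atTop.comp tendsto_natCast_atTop_atTop
  have hsmall : Tendsto (fun K : ℕ => C * (g * (Real.log K / (K : ℝ) ^ (1 - 1 / α)))) atTop
      (𝓝 0) := by
    have := ((isLittleO_log_rpow_atTop hβ).tendsto_div_nhds_zero.comp
      (tendsto_natCast_atTop_atTop (R := ℝ))).const_mul g |>.const_mul C
    simpa [Function.comp_def] using this
  have hRT : Tendsto (fun K : ℕ => ((K : ℝ) * δ') ^ (1 / α)) atTop atTop :=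
    (tendsto_rpow_atTop (by positivity)).comp
      (tendsto_natCast_atTop_atTop.atTop_mul_const hδ'0)
  have hlim : Tendsto (fun K : ℕ => ((1 - 1 / Real.log T) * (δ' ^ (1 / α) / α) - g) * Real.log K)
      atTop atTop := hlogK.const_mul_atTop (by linarith)
  filter_upwards [eventually_ge_atTop 1, hsmall.eventually (gt_mem_nhds (sub_pos.2 hδ'δ)),
    hRT.eventually_ge_atTop T, hlim.eventually_ge_atTop
      (-((1 - 1 / Real.log T) * (δ' ^ (1 / α) / α) * Real.log δ'))] with K hK hs hRT hl p hp q hq hS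
  by_contra! hlt
  have hK0 : (0 : ℝ) < K := by exact_mod_cast hK
  have hq0 : ∀ j, 0 < q j := fun j => by rw [hq]; positivity
  have hq1 : ∑ j, q j = 1 := by simp [hq, hK0.ne']
  set r : Fin K → ℝ := fun j => p j / q j with hr
  have hr0 : ∀ j, 0 ≤ r j := fun j => div_nonneg (hp.1 j) (hq0 j).le
  have hmean : ∀ f : Fin K → ℝ, ∑ j, q j * f j = 1 / (K : ℝ) * ∑ j, f j := fun f => by
    rw [Finset.mul_sum]
    exact Finset.sum_congr rfl fun j _ => by rw [hq]
  have hkl := (klDiv_eq_sum_klExcess hp.2 hq1 fun j h => absurd h (hq0 j).ne').trans (hmean fun j => klExcess (r j))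
  have hps := (powerSum_sub_one hp hq0 hq1 α).trans (hmean fun j => powerExcess α (r j))
  rw [one_div_mul_eq_div, eq_div_iff hK0.ne'] at hkl hps
  have hsplit := Finset.sum_filter_add_sum_filter_not Finset.univ (fun j => T ≤ r j)
    fun j => powerExcess α (r j)
  have hsm : ∑ j with ¬ T ≤ r j, powerExcess α (r j) ≤ C * ∑ j, klExcess (r j) := by
    rw [Finset.mul_sum]
    refine (Finset.sum_le_sum fun j hj => ?_).trans (Finset.sum_le_sum_of_subset_of_nonneg
      (Finset.filter_subset _ _) fun j _ _ => mul_nonneg hC0 (klExcess_nonneg (hr0 j)))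
    exact powerExcess_le_mul_klExcess hα hT1.le (hr0 j) (not_le.1 (Finset.mem_filter.1 hj).2).le
  have hbig : ∑ j with T ≤ r j, powerExcess α (r j) ≤ ∑ j with T ≤ r j, r j ^ α := by
    refine Finset.sum_le_sum fun j hj => ?_
    have := (Finset.mem_filter.1 hj).2
    unfold powerExcess
    nlinarith
  -- If the information divergence were below the claimed bound, cells with ratio below `T` would
  -- contribute at most `K(δ - δ')`, leaving at least `Kδ'` for the others. Their cheapest
  -- arrangement is one cell with ratio `(Kδ')^(1/α)`.
  have hR : (((K : ℝ) * δ') ^ (1 / α)) ^ α ≤ ∑ j with T ≤ r j, r j ^ α := by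
    rw [← Real.rpow_mul (by positivity), one_div_mul_cancel hα0.ne', Real.rpow_one]
    have h1 : C * ∑ j, klExcess (r j) ≤ K * (δ - δ') := by
      rw [← hkl]
      have : C * powerDiv 1 p q ≤ δ - δ' :=
        (mul_le_mul_of_nonneg_left hlt.le hC0).trans hs.le
      nlinarith
    have h2 : (K : ℝ) * δ ≤ ∑ j, powerExcess α (r j) := by
      rw [← hps]
      nlinarith
    nlinarith
  have hmain := mul_log_le_sum (Finset.univ.filter fun j => T ≤ r j) hα hT
    (fun j hj => (Finset.mem_filter.1 hj).2) hRT hR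
  -- The choice of `T` does not by itself give `log T ≥ 1`; a negative factor would make `g`
  -- negative, and then the divergence would be negative.
  have hlogT : 0 ≤ 1 - 1 / Real.log T := by
    by_contra! hneg
    have h1 : g < 0 := hTg.trans (mul_neg_of_neg_of_pos hneg (by positivity))
    have h2 : 0 ≤ powerDiv 1 p q := powerDiv_nonneg one_pos hp hq0 hq1
    have h3 : 0 ≤ Real.log K / (K : ℝ) ^ (1 - 1 / α) :=
      div_nonneg (Real.log_natCast_nonneg K) (by positivity)
    nlinarith
  have hkl2 : (1 - 1 / Real.log T) *
      (((K : ℝ) * δ') ^ (1 / α) * Real.log (((K : ℝ) * δ') ^ (1 / α))) ≤ powerDiv 1 p q * K := by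
    rw [hkl]
    refine (mul_le_mul_of_nonneg_left hmain hlogT).trans ?_
    rw [Finset.mul_sum]
    refine (Finset.sum_le_sum fun j hj => ?_).trans (Finset.sum_le_sum_of_subset_of_nonneg
      (Finset.filter_subset _ _) fun j _ _ => klExcess_nonneg (hr0 j))
    exact mul_log_le_klExcess hT1 (Finset.mem_filter.1 hj).2
  have hKα : (K : ℝ) ^ (1 - 1 / α) * (K : ℝ) ^ (1 / α) = K := by
    rw [← Real.rpow_add hK0]; simp
  have hKα0 : 0 < (K : ℝ) ^ (1 / α) := by positivity
  rw [Real.log_rpow (by positivity), Real.log_mul hK0.ne' hδ'0.ne',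
    Real.mul_rpow hK0.le hδ'0.le] at hkl2
  have hlt2 : powerDiv 1 p q * K < g * Real.log K * (K : ℝ) ^ (1 / α) := by
    have h1 := mul_lt_mul_of_pos_right hlt hK0
    refine h1.trans_eq ?_
    conv_lhs => rw [← hKα]
    have : (K : ℝ) ^ (1 - 1 / α) ≠ 0 := by positivity
    rw [hKα]
    nth_rewrite 3 [← hKα]
    field_simp
  have h3 := hkl2.trans_lt hlt2
  have h4 : (1 - 1 / Real.log T) * (δ' ^ (1 / α) / α) * (Real.log K + Real.log δ') <
      g * Real.log K := by
    refine lt_of_mul_lt_mul_right ?_ hKα0.le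
    refine lt_of_eq_of_lt ?_ h3
    ring
  linarith

end HighOrder

end PowerDivergence

namespace PowerDivergence

/-! ### Bahadur functions of order above one under uniform hypotheses. -/

section HighOrderBahadur

variable {k : ℕ → ℕ} {P Q : (n : ℕ) → Fin (k n) → ℝ}

/-- The generator of the Bahadur function of order `α > 1` under uniform hypotheses. -/
noncomputable def peakRate (α : ℝ) (K : ℕ) : ℝ := (K : ℝ) ^ (1 - 1 / α) / Real.log K

/-- The Bahadur function of order `α > 1` under uniform hypotheses. -/
noncomputable def peakLevel (α x : ℝ) : ℝ := (α * (α - 1) * x) ^ (1 / α) / α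

lemma one_sub_one_div_pos {α : ℝ} (hα : 1 < α) : 0 < 1 - 1 / α := by
  rw [sub_pos, div_lt_one (by linarith)]; exact hα

lemma tendsto_peakRate {α : ℝ} (hα : 1 < α) : Tendsto (peakRate α) atTop atTop := by
  have hβ := one_sub_one_div_pos hα
  have h1 : Tendsto (fun x : ℝ => Real.log x / x ^ (1 - 1 / α)) atTop (𝓝[>] 0) := by
    refine tendsto_nhdsWithin_iff.2 ⟨(isLittleO_log_rpow_atTop hβ).tendsto_div_nhds_zero, ?_⟩
    filter_upwards [eventually_gt_atTop 1] with x hx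
    have := Real.log_pos hx
    exact div_pos this (by positivity)
  have h2 := h1.inv_tendsto_nhdsGT_zero.comp (tendsto_natCast_atTop_atTop (R := ℝ))
  refine h2.congr fun K => ?_
  simp [peakRate]

/-- The logarithm of the type count, `k log(n+1)`, multiplied by `k^(1-1/α)/n`, is negligible: this
is why the exponent is `2 - 1/α`. -/
lemma tendsto_peak_condition {α : ℝ} (hα : 1 < α)
    (hk : Tendsto (fun n : ℕ => (k n : ℝ) ^ (2 - 1 / α) * Real.log n / n) atTop (𝓝 0)) :
    Tendsto (fun n : ℕ => (k n : ℝ) * (k n : ℝ) ^ (1 - 1 / α) * Real.log (n + 1) / n) atTop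
      (𝓝 0) := by
  have h := tendsto_mul_log_succ (fun n => by positivity) hk
  refine h.congr fun n => ?_
  have hβ := one_sub_one_div_pos hα
  congr 2
  rw [← Real.rpow_one_add' (by positivity) (by linarith)]
  congr 1; ring

lemma tendsto_peak_rpow_div (hM : CellModel k P Q) {α : ℝ} (hα : 1 < α)
    (hk : Tendsto (fun n : ℕ => (k n : ℝ) ^ (2 - 1 / α) * Real.log n / n) atTop (𝓝 0)) :
    Tendsto (fun n : ℕ => (k n : ℝ) ^ (1 - 1 / α) / n) atTop (𝓝 0) := by
  have hkR : Tendsto (fun n => (k n : ℝ)) atTop atTop :=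
    tendsto_natCast_atTop_atTop.comp hM.card_tendsto
  refine squeeze_zero' (Eventually.of_forall fun n => by positivity) ?_
    (tendsto_peak_condition hα hk)
  filter_upwards [eventually_ge_atTop 2, hkR.eventually_ge_atTop 1] with n hn hkn
  have h1 : 1 ≤ Real.log (n + 1) := by
    rw [Real.le_log_iff_exp_le (by positivity)]
    have : (2 : ℝ) ≤ n := by exact_mod_cast hn
    linarith [Real.exp_one_lt_d9]
  refine div_le_div_of_nonneg_right ?_ n.cast_nonneg
  have h2 : 0 ≤ (k n : ℝ) ^ (1 - 1 / α) := by positivity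
  have h3 : (k n : ℝ) ^ (1 - 1 / α) ≤ (k n : ℝ) * (k n : ℝ) ^ (1 - 1 / α) := by nlinarith
  have h4 : 0 ≤ (k n : ℝ) * (k n : ℝ) ^ (1 - 1 / α) := by positivity
  nlinarith

lemma lt_powerDiv_of_peak {K : ℕ} {p q : Fin K → ℝ} {α x : ℝ} (hα : 1 < α)
    (hp : p ∈ stdSimplex ℝ (Fin K)) (hq : ∀ j, q j = 1 / K) (j : Fin K)
    (h : α * (α - 1) * x < p j ^ α * (K : ℝ) ^ (α - 1) - 1 / K - α * p j) :
    x < powerDiv α p q := by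
  have hK0 : (0 : ℝ) < K := by exact_mod_cast j.pos
  have hq0 : ∀ j, 0 < q j := fun j => by rw [hq]; positivity
  have hq1 : ∑ j, q j = 1 := by simp [hq, hK0.ne']
  have h1 := powerSum_sub_one hp hq0 hq1 α
  have h2 := Finset.single_le_sum (f := fun j => q j * powerExcess α (p j / q j)) (fun i _ =>
    mul_nonneg (hq0 i).le (powerExcess_nonneg hα.le (div_nonneg (hp.1 i) (hq0 i).le)))
    (Finset.mem_univ j)
  simp only [← h1] at h2
  have h3 : q j * powerExcess α (p j / q j) =
      p j ^ α * (K : ℝ) ^ (α - 1) - 1 / K - α * (p j - 1 / K) := by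
    have h4 := rpow_mul_rpow_one_sub (hp.1 j) (hq0 j) α
    have h5 : q j ^ (1 - α) = (K : ℝ) ^ (α - 1) := by
      rw [hq, one_div, Real.inv_rpow hK0.le, ← Real.rpow_neg hK0.le, neg_sub]
    have := (hq0 j).ne'
    rw [powerExcess, mul_sub, mul_sub, ← h4, h5, ← hq j]
    field_simp
  rw [h3] at h2
  have h6 := one_add_mul_powerDiv (by linarith) hα.ne' p q
  have h7 : 0 < α * (α - 1) := by nlinarith
  have h8 : 0 < α * (1 / (K : ℝ)) := by positivity
  refine lt_of_mul_lt_mul_left (a := α * (α - 1)) ?_ h7.le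
  linarith

/-- One cell receives relative frequency `u ≈ A/K^(1-1/α)`. Its contribution to the power sum tends
to `A^α`, beyond what `x` requires, and the binomial probability is about `(1/(K u))^(n u)` with `K
u ≈ A K^(1/α)`, whence the limit `A/α`. -/
lemma errorProb_peak_bound (hM : CellModel k P Q) (hU : ∀ n, 1 ≤ n → ∀ j, Q n j = 1 / (k n : ℝ))
    {α x A : ℝ} (hα : 1 < α) (hA0 : 0 < A) (hA : α * (α - 1) * x < A ^ α)
    (hk : Tendsto (fun n : ℕ => (k n : ℝ) ^ (2 - 1 / α) * Real.log n / n) atTop (𝓝 0)) :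
    (∀ᶠ n : ℕ in atTop, 0 < errorProb k Q α n x) ∧
    ∃ b : ℕ → ℝ, Tendsto b atTop (𝓝 (A / α)) ∧
      ∀ᶠ n : ℕ in atTop, -(peakRate α (k n) / n) * Real.log (errorProb k Q α n x) ≤ b n := by
  have hα0 : 0 < α := by linarith
  have hβ := one_sub_one_div_pos hα
  have hkR : Tendsto (fun n => (k n : ℝ)) atTop atTop :=
    tendsto_natCast_atTop_atTop.comp hM.card_tendsto
  set β := 1 - 1 / α with hβdef
  have hKβ : Tendsto (fun n => (k n : ℝ) ^ β) atTop atTop := (tendsto_rpow_atTop hβ).comp hkR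
  have hlogK : Tendsto (fun n => Real.log (k n : ℝ)) atTop atTop := Real.tendsto_log_atTop.comp hkR
  have hKn : Tendsto (fun n : ℕ => (k n : ℝ) ^ β / n) atTop (𝓝 0) :=
    tendsto_peak_rpow_div hM hα hk
  -- Number of observations in the overloaded cell; `w` is its rescaled frequency, and rounding up
  -- moves it from `A` by at most `K^(1-1/α)/n`.
  let a : ℕ → ℕ := fun n => ⌈n * (A / (k n : ℝ) ^ β)⌉₊
  let u : ℕ → ℝ := fun n => (a n : ℝ) / n
  let w : ℕ → ℝ := fun n => u n * (k n : ℝ) ^ β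
  have hwge : ∀ᶠ n in atTop, A ≤ w n := by
    filter_upwards [eventually_ge_atTop 1, hKβ.eventually_gt_atTop 0] with n hn hkn
    have hn0 : (0 : ℝ) < n := by exact_mod_cast hn
    have h1 : (n : ℝ) * (A / (k n : ℝ) ^ β) ≤ a n := Nat.le_ceil _
    rw [← div_le_iff₀ hkn, le_div_iff₀ hn0]
    linarith
  have hwle : ∀ᶠ n in atTop, w n ≤ A + (k n : ℝ) ^ β / n := by
    filter_upwards [eventually_ge_atTop 1, hKβ.eventually_gt_atTop 0] with n hn hkn
    have hn0 : (0 : ℝ) < n := by exact_mod_cast hn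
    have h1 : (a n : ℝ) < n * (A / (k n : ℝ) ^ β) + 1 := Nat.ceil_lt_add_one (by positivity)
    have h2 : u n ≤ A / (k n : ℝ) ^ β + 1 / n := by
      rw [div_le_iff₀ hn0]
      refine h1.le.trans_eq ?_
      field_simp
    calc w n ≤ (A / (k n : ℝ) ^ β + 1 / n) * (k n : ℝ) ^ β :=
          mul_le_mul_of_nonneg_right h2 hkn.le
      _ = _ := by field_simp
  have hw : Tendsto w atTop (𝓝 A) :=
    tendsto_of_tendsto_of_tendsto_of_le_of_le' tendsto_const_nhds
      (by simpa using hKn.const_add A) hwge hwle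
  have hwu : ∀ᶠ n in atTop, u n = w n / (k n : ℝ) ^ β := by
    filter_upwards [hKβ.eventually_gt_atTop 0] with n hkn
    exact (mul_div_cancel_right₀ _ hkn.ne').symm
  have hu : Tendsto u atTop (𝓝 0) := (hw.div_atTop hKβ).congr' (hwu.mono fun n h => h.symm)
  have hevent : ∀ᶠ n in atTop, α * (α - 1) * x < A ^ α - 1 / k n - α * u n := by
    have : Tendsto (fun n => A ^ α - 1 / (k n : ℝ) - α * u n) atTop (𝓝 (A ^ α - 0 - α * 0)) :=
      (((tendsto_const_nhds.div_atTop hkR).const_sub _)).sub (hu.const_mul α)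
    simp only [sub_zero, mul_zero] at this
    exact this.eventually (lt_mem_nhds hA)
  have hprob : ∀ᶠ n in atTop, 0 < 1 / u n ∧ 0 < u n ∧ 2 ≤ (k n : ℝ) ∧
      (1 / u n) ^ a n * ((1 / (k n : ℝ)) ^ a n * (1 - 1 / (k n : ℝ)) ^ n) ≤
        errorProb k Q α n x := by
    filter_upwards [eventually_ge_atTop 1, hkR.eventually_ge_atTop 2, hevent, hwge, hwu,
      hu.eventually (gt_mem_nhds one_pos)] with n hn hkn hev hwn hwun hun
    have hn0 : (0 : ℝ) < n := by exact_mod_cast hn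
    have hk0 : (0 : ℝ) < k n := by linarith
    have hQ := hM.null_mem n hn
    have := isProbabilityMeasure_sampleLaw hQ n
    have hu0 : 0 < u n := by
      rw [hwun]
      exact div_pos (by linarith) (by positivity)
    have han : a n ≤ n := by
      rw [div_lt_one hn0] at hun
      exact_mod_cast hun.le
    have hk0' : 0 < k n := by exact_mod_cast hk0
    let j : Fin (k n) := ⟨0, hk0'⟩
    refine ⟨by positivity, hu0, hkn, ?_⟩
    have h1 := le_sampleLaw_empirical_eq hQ j han
    rw [hU n hn] at h1
    have hk1 : 1 / (k n : ℝ) ≤ 1 := by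
      rw [div_le_one hk0]; linarith
    calc _ ≤ ((n : ℝ) / a n) ^ a n * ((1 / (k n : ℝ)) ^ a n * (1 - 1 / (k n : ℝ)) ^ (n - a n)) := by
          have h2 : 1 / u n = n / a n := one_div_div _ _
          rw [h2]
          gcongr (?_ ^ _) * (_ * ?_)
          exact pow_le_pow_of_le_one (by linarith) (by linarith [one_div_pos.2 hk0])
            (Nat.sub_le _ _)
      _ ≤ _ := h1
      _ ≤ _ := by
          refine measureReal_mono fun ω hω => ?_
          refine lt_powerDiv_of_peak hα (empirical_mem hn ω) (hU n hn) j ?_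
          have hω' : empirical ω j = u n := hω
          rw [hω']
          refine hev.trans_le ?_
          have h3 : u n ^ α * (k n : ℝ) ^ (α - 1) = w n ^ α := by
            change _ = (u n * (k n : ℝ) ^ β) ^ α
            rw [Real.mul_rpow hu0.le (by positivity), ← Real.rpow_mul hk0.le]
            congr 2
            rw [hβdef]; field_simp
          rw [h3]
          gcongr
  -- The first term is the cost of filling the chosen cell. The second is the cost of the remaining
  -- observations avoiding it, from `-log(1 - 1/K) ≤ 2/K`.
  refine ⟨?_, fun n => w n * (Real.log (w n) / Real.log (k n) + 1 / α) +
    2 * ((k n : ℝ) ^ (-(1 / α)) / Real.log (k n)), ?_, ?_⟩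
  · filter_upwards [hprob] with n ⟨h1, _, h3, h4⟩
    refine lt_of_lt_of_le ?_ h4
    have hk0 : (0 : ℝ) < k n := by linarith
    have : 0 < 1 - 1 / (k n : ℝ) := by
      rw [sub_pos, div_lt_one hk0]; linarith
    positivity
  · have h1 : Tendsto (fun n => Real.log (w n) / Real.log (k n)) atTop (𝓝 0) :=
      (hw.log hA0.ne').div_atTop hlogK
    have h2 : Tendsto (fun n => (k n : ℝ) ^ (-(1 / α)) / Real.log (k n)) atTop (𝓝 0) :=
      ((tendsto_rpow_neg_atTop (by positivity)).comp hkR).div_atTop hlogK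
    have := (hw.mul (h1.add_const (1 / α))).add (h2.const_mul 2)
    simpa [div_eq_mul_inv] using this
  · filter_upwards [hprob, eventually_ge_atTop 1, hwge, hwu] with n ⟨h1, hu0, h3, h4⟩ hn hwn hwun
    have hn0 : (0 : ℝ) < n := by exact_mod_cast hn
    have hk0 : (0 : ℝ) < k n := by linarith
    have hlk : 0 < Real.log (k n) := Real.log_pos (by linarith)
    have hk1 : 0 < 1 - 1 / (k n : ℝ) := by
      rw [sub_pos, div_lt_one hk0]; linarith
    have hw0 : 0 < w n := by linarith
    have h5 := Real.log_le_log (by positivity) h4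
    rw [Real.log_mul (by positivity) (by positivity), Real.log_mul (by positivity) (by positivity),
      Real.log_pow, Real.log_pow, Real.log_pow, one_div, one_div, Real.log_inv, Real.log_inv] at h5
    have h6 : -Real.log (1 - (k n : ℝ)⁻¹) ≤ 2 / k n := by
      have h7 := Real.log_le_sub_one_of_pos (inv_pos.2 hk1)
      rw [Real.log_inv, one_div] at h7
      refine h7.trans ?_
      have h8 : (1 - (k n : ℝ)⁻¹)⁻¹ - 1 = 1 / (k n - 1) := by
        have : (k n : ℝ) - 1 ≠ 0 := by linarith
        field_simp
        ring
      rw [h8, div_le_div_iff₀ (by linarith) hk0]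
      linarith
    have han : (a n : ℝ) = n * u n := (mul_div_cancel₀ _ hn0.ne').symm
    have hlu : Real.log (u n) = Real.log (w n) - β * Real.log (k n) := by
      rw [hwun, Real.log_div hw0.ne' (by positivity), Real.log_rpow hk0]
    have h9 : -Real.log (errorProb k Q α n x) ≤
        n * (u n * (Real.log (w n) + (1 / α) * Real.log (k n)) + 2 / k n) := by
      have : n * (-Real.log (1 - (k n : ℝ)⁻¹)) ≤ n * (2 / k n) := by gcongr
      rw [han, hlu, hβdef] at h5
      linarith
    have hc : 0 < peakRate α (k n) := div_pos (by positivity) hlk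
    calc _ = peakRate α (k n) / n * (-Real.log (errorProb k Q α n x)) := by ring
      _ ≤ peakRate α (k n) / n *
          (n * (u n * (Real.log (w n) + (1 / α) * Real.log (k n)) + 2 / k n)) := by gcongr
      _ = _ := by
          have hr : (k n : ℝ) ^ (-(1 / α)) = (k n : ℝ) ^ β / k n := by
            rw [← Real.rpow_sub_one hk0.ne', hβdef]
            congr 1; ring
          rw [hr]
          simp only [peakRate, ← hβdef, w]
          field_simp

lemma tendsto_peakRate_div (hM : CellModel k P Q) {α : ℝ} (hα : 1 < α)
    (hk : Tendsto (fun n : ℕ => (k n : ℝ) ^ (2 - 1 / α) * Real.log n / n) atTop (𝓝 0)) :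
    Tendsto (fun n : ℕ => peakRate α (k n) / n) atTop (𝓝 0) := by
  have hlogK : Tendsto (fun n => Real.log (k n : ℝ)) atTop atTop :=
    Real.tendsto_log_atTop.comp (tendsto_natCast_atTop_atTop.comp hM.card_tendsto)
  have h0 := (tendsto_peak_rpow_div hM hα hk).div_atTop hlogK
  refine h0.congr fun n => ?_
  unfold peakRate
  ring

lemma levels_of_one_lt {α : ℝ} (hα : 1 ≤ α) {x : ℝ} (hx : 0 < x) : x ∈ levels α :=
  ⟨hx, by nlinarith [mul_nonneg (mul_nonneg (zero_le_one.trans hα) (sub_nonneg.2 hα)) hx.le]⟩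

lemma peakLevel_pos {α x : ℝ} (hα : 1 < α) (hx : 0 < x) : 0 < peakLevel α x := by
  have : 0 < α - 1 := by linarith
  have : 0 < α := by linarith
  unfold peakLevel
  positivity

lemma isBahadurFunction_peakLevel (hM : CellModel k P Q)
    (hU : ∀ n, 1 ≤ n → ∀ j, Q n j = 1 / (k n : ℝ)) {α : ℝ} (hα : 1 < α)
    (hk : Tendsto (fun n : ℕ => (k n : ℝ) ^ (2 - 1 / α) * Real.log n / n) atTop (𝓝 0)) :
    IsBahadurFunction k Q α (peakLevel α) fun n => peakRate α (k n) where
  continuousOn := by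
    have : Continuous fun x : ℝ => x ^ (1 / α) := Real.continuous_rpow_const (by positivity)
    unfold peakLevel
    fun_prop
  pos x hx := peakLevel_pos hα hx.1
  generator_pos := ((tendsto_peakRate hα).comp hM.card_tendsto).eventually_gt_atTop 0
  tendsto x hx := by
    have hα0 : 0 < α := by linarith
    have hδ : 0 < α * (α - 1) * x := mul_pos (by nlinarith) hx.1
    set δ := α * (α - 1) * x with hδdef
    have hpow : ∀ A : ℝ, δ ^ (1 / α) < A → 0 < A ∧ δ < A ^ α := by
      intro A hA
      have h1 : 0 < δ ^ (1 / α) := by positivity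
      refine ⟨h1.trans hA, ?_⟩
      have := Real.rpow_lt_rpow h1.le hA hα0
      rwa [← Real.rpow_mul hδ.le, one_div_mul_cancel hα0.ne', Real.rpow_one] at this
    rw [tendsto_order]
    constructor
    · intro b hb
      obtain ⟨g, hbg, hg⟩ := exists_between hb
      -- Any admissible `A` will do here, as only the positivity of the error probability is needed.
      obtain ⟨h1, h2⟩ := hpow (δ ^ (1 / α) + 1) (by linarith)
      have hpos := (errorProb_peak_bound (x := x) hM hU hα h1 h2 hk).1
      have hdet := hM.card_tendsto.eventually (eventually_le_klDiv_uniform hα hδ hg)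
      have hlogK : Tendsto (fun n => Real.log (k n : ℝ)) atTop atTop :=
        Real.tendsto_log_atTop.comp (tendsto_natCast_atTop_atTop.comp hM.card_tendsto)
      have hlim := (tendsto_peak_condition hα hk).eventually (gt_mem_nhds (sub_pos.2 hbg))
      filter_upwards [hpos, hdet, hlogK.eventually_ge_atTop 1, hlim, eventually_ge_atTop 1]
        with n hpos hdet hlk hlim hn
      have hn0 : (0 : ℝ) < n := by exact_mod_cast hn
      have hQ := hM.null_mem n hn
      have h3 := neg_log_errorProb_ge hn hQ hpos fun p hp hx => by
        refine hdet p hp (Q n) (hU n hn) ?_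
        rw [← one_add_mul_powerDiv hα0.ne' hα.ne', hδdef]
        have : 0 < α * (α - 1) := by nlinarith
        gcongr
      have hk0 : (0 : ℝ) < k n := by
        have : 0 < k n := Nat.pos_of_ne_zero fun h => by simp [h] at hlk; linarith
        exact_mod_cast this
      have hlk0 : 0 < Real.log (k n) := by linarith
      have hc : 0 < peakRate α (k n) := div_pos (by positivity) hlk0
      have hK : 0 < (k n : ℝ) ^ (1 - 1 / α) := by positivity
      have h4 : peakRate α (k n) * (k n * Real.log (n + 1)) / n ≤
          (k n : ℝ) * (k n : ℝ) ^ (1 - 1 / α) * Real.log (n + 1) / n := by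
        have h5 : peakRate α (k n) ≤ (k n : ℝ) ^ (1 - 1 / α) := div_le_self hK.le hlk
        have h6 : 0 ≤ Real.log ((n : ℝ) + 1) := Real.log_nonneg (by linarith)
        calc _ ≤ (k n : ℝ) ^ (1 - 1 / α) * (k n * Real.log (n + 1)) / n := by gcongr
          _ = _ := by ring
      calc b < g - peakRate α (k n) * (k n * Real.log (n + 1)) / n := by linarith
        _ = peakRate α (k n) / n * (n * (g * (Real.log (k n) / (k n : ℝ) ^ (1 - 1 / α))) -
              k n * Real.log (n + 1)) := by
            unfold peakRate
            field_simp
        _ ≤ peakRate α (k n) / n * (-Real.log (errorProb k Q α n x)) := by gcongr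
        _ = _ := by ring
    · intro b hb
      obtain ⟨g, hbg, hg⟩ := exists_between hb
      have hA : δ ^ (1 / α) < g * α := (div_lt_iff₀ hα0).1 hbg
      obtain ⟨h1, h2⟩ := hpow _ hA
      obtain ⟨b', hb', hle⟩ := (errorProb_peak_bound (x := x) hM hU hα h1 h2 hk).2
      rw [mul_div_cancel_right₀ _ hα0.ne'] at hb'
      filter_upwards [hle, hb'.eventually (gt_mem_nhds hg)] with n h3 h4
      exact h3.trans_lt h4

end HighOrderBahadur

end PowerDivergence

namespace PowerDivergence

/-! ### Consistency under the hypothesis and under the alternative. -/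

section Consistency

variable {k : ℕ → ℕ} {P Q : (n : ℕ) → Fin (k n) → ℝ}

/-- The error probability is `exp(-(g x + o(1)) n / c n)` and `n / c n` tends to infinity. -/
lemma tendsto_errorProb {α : ℝ} {g : ℝ → ℝ} {c : ℕ → ℝ} (hg : IsBahadurFunction k Q α g c)
    (hc : Tendsto (fun n : ℕ => c n / n) atTop (𝓝 0)) {x : ℝ} (hx : x ∈ levels α) :
    Tendsto (fun n => errorProb k Q α n x) atTop (𝓝 0) := by
  have hgx := hg.pos x hx
  have hlim := hg.tendsto x hx
  have hc' : Tendsto (fun n : ℕ => c n / n) atTop (𝓝[>] 0) := by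
    refine tendsto_nhdsWithin_iff.2 ⟨hc, ?_⟩
    filter_upwards [hg.generator_pos, eventually_ge_atTop 1] with n h1 h2
    exact div_pos h1 (by exact_mod_cast h2)
  have hmul := hlim.pos_mul_atTop hgx hc'.inv_tendsto_nhdsGT_zero
  have hexp := Real.tendsto_exp_neg_atTop_nhds_zero.comp hmul
  refine hexp.congr' ?_
  filter_upwards [hlim.eventually (lt_mem_nhds hgx), hg.generator_pos, eventually_ge_atTop 1]
    with n h1 h2 h3
  have hn0 : (0 : ℝ) < n := by exact_mod_cast h3
  -- Since `Real.log 0 = 0`, a zero error probability would contradict the positive normalised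
  -- logarithm.
  have h4 : 0 < errorProb k Q α n x := by
    refine lt_of_le_of_ne (errorProb_nonneg k Q α n x) fun h => ?_
    rw [← h] at h1
    simp at h1
  have h5 : -(-(c n / n) * Real.log (errorProb k Q α n x) * (c n / n)⁻¹) =
      Real.log (errorProb k Q α n x) := by
    field_simp
  simp only [Function.comp_apply, Pi.inv_apply]
  rw [h5, Real.exp_log h4]

/-- Every `x` in `(0, 1]` is a level, because `α(α-1) ≥ -1/4`. -/
lemma exists_mem_levels_lt (α : ℝ) {ε : ℝ} (hε : 0 < ε) : ∃ x ∈ levels α, x < ε := by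
  refine ⟨min (ε / 2) 1, ⟨by positivity, ?_⟩, (min_le_left _ _).trans_lt (by linarith)⟩
  have h1 : min (ε / 2) 1 ≤ 1 := min_le_right _ _
  have h2 : 0 < min (ε / 2) 1 := by positivity
  nlinarith [sq_nonneg (α - 1 / 2)]

lemma tendsto_statistic_null (hM : CellModel k P Q) (hR : RegularNull k Q) {α : ℝ} (hα : 0 < α)
    {g : ℝ → ℝ} {c : ℕ → ℝ} (hg : IsBahadurFunction k Q α g c)
    (hc : Tendsto (fun n : ℕ => c n / n) atTop (𝓝 0)) {ε : ℝ} (hε : 0 < ε) :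
    Tendsto (fun n => (sampleLaw (Q n) n).real {ω | ε ≤ |statistic α (Q n) ω|}) atTop (𝓝 0) := by
  obtain ⟨x, hx, hxε⟩ := exists_mem_levels_lt α hε
  refine squeeze_zero' (Eventually.of_forall fun n => measureReal_nonneg) ?_
    (tendsto_errorProb hg hc hx)
  filter_upwards [eventually_ge_atTop 1] with n hn
  have hQ := hM.null_mem n hn
  have := isProbabilityMeasure_sampleLaw hQ n
  refine measureReal_mono fun ω hω => ?_
  have h0 : 0 ≤ statistic α (Q n) ω := powerDiv_nonneg hα (empirical_mem hn ω) (hR.pos hn) hQ.2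
  have hω' : ε ≤ |statistic α (Q n) ω| := hω
  rw [abs_of_nonneg h0] at hω'
  exact hxε.trans_le hω'

/-- A level that the information divergence of the empirical distribution from the true one
exceeds with a probability tending to zero. -/
noncomputable def typeRadius (K n : ℕ) : ℝ := 2 * (K * Real.log (n + 1) / n)

lemma tendsto_typeRadius
    (hk : Tendsto (fun n : ℕ => (k n : ℝ) * Real.log n / n) atTop (𝓝 0)) :
    Tendsto (fun n => typeRadius (k n) n) atTop (𝓝 0) := by
  simpa [typeRadius] using (tendsto_mul_log_succ (fun n => (k n).cast_nonneg) hk).const_mul 2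

lemma tendsto_klDiv_empirical (hM : CellModel k P Q) :
    Tendsto (fun n => (sampleLaw (P n) n).real
      {ω | typeRadius (k n) n ≤ powerDiv 1 (empirical ω) (P n)}) atTop (𝓝 0) := by
  refine squeeze_zero' (Eventually.of_forall fun n => measureReal_nonneg) ?_
    (tendsto_one_div_add_atTop_nhds_zero_nat (𝕜 := ℝ))
  filter_upwards [eventually_ge_atTop 1, hM.card_tendsto.eventually_ge_atTop 1] with n hn hkn
  have hn0 : (0 : ℝ) < n := by exact_mod_cast hn
  refine (sampleLaw_klDiv_ge_le hn (hM.alternative_mem n hn) _).trans ?_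
  -- Of the factor 2 in the radius, one half cancels the type count and the other leaves
  -- `(n+1)^(-k)`.
  have h1 : -(n * typeRadius (k n) n) = -((k n + k n : ℕ) * Real.log (n + 1)) := by
    unfold typeRadius
    push_cast
    field_simp
    ring
  have hpos : (0 : ℝ) < n + 1 := by linarith
  rw [h1, Real.exp_neg, Real.exp_nat_mul, Real.exp_log hpos, pow_add, mul_inv,
    mul_inv_cancel_left₀ (by positivity), one_div]
  refine inv_anti₀ hpos ?_
  exact le_self_pow₀ (by linarith) (by omega)

/-- Reduces consistency to a deterministic stability statement on small information balls around `P
n`. Absolute continuity may be assumed since cells of probability zero stay empty. -/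
lemma tendsto_statistic_alternative (hM : CellModel k P Q) {α Δ : ℝ}
    (h : ∀ ε : ℝ, 0 < ε → ∀ᶠ n in atTop, ∀ u ∈ stdSimplex ℝ (Fin (k n)),
      (∀ j, P n j = 0 → u j = 0) → powerDiv 1 u (P n) < typeRadius (k n) n →
        |powerDiv α u (Q n) - Δ| < ε) {ε : ℝ} (hε : 0 < ε) :
    Tendsto (fun n => (sampleLaw (P n) n).real {ω | ε ≤ |statistic α (Q n) ω - Δ|})
      atTop (𝓝 0) := by
  refine squeeze_zero' (Eventually.of_forall fun n => measureReal_nonneg) ?_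
    (tendsto_klDiv_empirical hM)
  filter_upwards [eventually_ge_atTop 1, h ε hε] with n hn h
  refine sampleLaw_real_le_of_ac (hM.alternative_mem n hn) fun ω hω hac => ?_
  by_contra hlt
  exact absurd (h _ (empirical_mem hn ω) hac (not_le.1 hlt)) (not_lt.2 hω)

lemma tendsto_powerSum {α Δ : ℝ} (hI : Identifiable k P Q α Δ) (h0 : α ≠ 0) (h1 : α ≠ 1) :
    Tendsto (fun n => powerSum α (P n) (Q n)) atTop (𝓝 (1 + α * (α - 1) * Δ)) := by
  refine ((hI.tendsto.const_mul (α * (α - 1))).const_add 1).congr fun n => ?_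
  exact one_add_mul_powerDiv h0 h1 _ _

lemma abs_powerDiv_sub_lt_of_powerSum {α Δ : ℝ} (h0 : α ≠ 0) (h1 : α ≠ 1)
    (hI : Identifiable k P Q α Δ) {R : (n : ℕ) → (Fin (k n) → ℝ) → Prop}
    (h : ∀ ε : ℝ, 0 < ε → ∀ᶠ n in atTop, ∀ u, R n u →
      |powerSum α u (Q n) - powerSum α (P n) (Q n)| < ε) (ε : ℝ) (hε : 0 < ε) :
    ∀ᶠ n in atTop, ∀ u, R n u → |powerDiv α u (Q n) - Δ| < ε := by
  have hc : 0 < |α * (α - 1)| := abs_pos.2 (mul_ne_zero h0 (sub_ne_zero.2 h1))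
  have hlim := (Metric.tendsto_nhds.1 (tendsto_powerSum hI h0 h1)) (ε / 2 * |α * (α - 1)|)
    (by positivity)
  filter_upwards [h (ε / 2 * |α * (α - 1)|) (by positivity), hlim] with n h2 h3 u hu
  rw [Real.dist_eq] at h3
  have h4 := (abs_add_le _ _).trans_lt (add_lt_add (h2 u hu) h3)
  rw [← one_add_mul_powerDiv h0 h1 u] at h4
  have h5 : 1 + α * (α - 1) * powerDiv α u (Q n) - powerSum α (P n) (Q n) +
      (powerSum α (P n) (Q n) - (1 + α * (α - 1) * Δ)) =
        α * (α - 1) * (powerDiv α u (Q n) - Δ) := by ring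
  rw [h5, abs_mul] at h4
  refine lt_of_mul_lt_mul_left (h4.trans_eq ?_) hc.le
  ring

lemma sum_abs_sub_le {K : ℕ} {u v : Fin K → ℝ} {η b : ℝ} (hη : 0 ≤ η)
    (hu : u ∈ stdSimplex ℝ (Fin K)) (hv : v ∈ stdSimplex ℝ (Fin K))
    (h : ∑ j with η * v j < |u j - v j|, max (u j) (v j) ≤ b) :
    ∑ j, |u j - v j| ≤ η + b := by
  rw [← Finset.sum_filter_add_sum_filter_not Finset.univ (fun j => η * v j < |u j - v j|), add_comm]
  refine add_le_add ?_ (le_trans (Finset.sum_le_sum fun j _ => ?_) h)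
  · calc _ ≤ ∑ j with ¬ η * v j < |u j - v j|, η * v j :=
          Finset.sum_le_sum fun j hj => not_lt.1 (Finset.mem_filter.1 hj).2
      _ ≤ ∑ j, η * v j := Finset.sum_le_sum_of_subset_of_nonneg (Finset.filter_subset _ _)
          fun j _ _ => mul_nonneg hη (hv.1 j)
      _ = η := by rw [← Finset.mul_sum, hv.2, mul_one]
  · have h1 := hu.1 j
    have h2 := hv.1 j
    rw [abs_le]
    constructor
    · linarith [le_max_right (u j) (v j)]
    · linarith [le_max_left (u j) (v j)]

lemma abs_powerSum_sub_le_of_lt_one {K : ℕ} {u v q : Fin K → ℝ} {α : ℝ} (h0 : 0 < α) (h1 : α < 1)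
    (hu : u ∈ stdSimplex ℝ (Fin K)) (hv : v ∈ stdSimplex ℝ (Fin K))
    (hq : q ∈ stdSimplex ℝ (Fin K)) :
    |powerSum α u q - powerSum α v q| ≤ (∑ j, |u j - v j|) ^ α := by
  have h := sum_rpow_mul_rpow_le Finset.univ (fun j _ => abs_nonneg (u j - v j))
    (fun j _ => hq.1 j) h0 h1
  rw [hq.2, Real.one_rpow, mul_one] at h
  refine le_trans ?_ h
  rw [powerSum, powerSum, ← Finset.sum_sub_distrib]
  refine (Finset.abs_sum_le_sum_abs _ _).trans (Finset.sum_le_sum fun j _ => ?_)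
  have := Real.rpow_nonneg (hq.1 j) (1 - α)
  rw [← sub_mul, abs_mul, abs_of_nonneg this]
  gcongr
  exact abs_rpow_sub_rpow_le (hu.1 j) (hv.1 j) h0.le h1.le

lemma tendsto_statistic_alternative_of_lt_one (hM : CellModel k P Q) {α Δ : ℝ} (h0 : 0 < α)
    (h1 : α < 1) (hI : Identifiable k P Q α Δ)
    (hk : Tendsto (fun n : ℕ => (k n : ℝ) * Real.log n / n) atTop (𝓝 0)) {ε : ℝ} (hε : 0 < ε) :
    Tendsto (fun n => (sampleLaw (P n) n).real {ω | ε ≤ |statistic α (Q n) ω - Δ|})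
      atTop (𝓝 0) := by
  refine tendsto_statistic_alternative hM (fun ε hε => ?_) hε
  have := abs_powerDiv_sub_lt_of_powerSum h0.ne' h1.ne hI (R := fun n u =>
    u ∈ stdSimplex ℝ (Fin (k n)) ∧ (∀ j, P n j = 0 → u j = 0) ∧
      powerDiv 1 u (P n) < typeRadius (k n) n) ?_ ε hε
  · filter_upwards [this] with n h u hu hac hlt using h u ⟨hu, hac, hlt⟩
  intro ε hε
  have hc : Tendsto (fun η : ℝ => (η + η) ^ α) (𝓝[>] 0) (𝓝 0) := by
    have : ContinuousAt (fun η : ℝ => (η + η) ^ α) 0 :=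
      (continuousAt_id.add continuousAt_id).rpow_const (Or.inr h0.le)
    have h := this.tendsto.mono_left (nhdsWithin_le_nhds (s := Set.Ioi 0))
    simpa [h0.ne'] using h
  obtain ⟨η, hηε, hη0, hη1⟩ :=
    ((hc.eventually (gt_mem_nhds hε)).and (Ioo_mem_nhdsGT one_pos)).exists
  obtain ⟨c, hc0, hbad⟩ := exists_sum_max_le_klDiv hη0 hη1
  have hrad := (tendsto_typeRadius hk).eventually (gt_mem_nhds (mul_pos hη0 hc0))
  filter_upwards [hrad, eventually_ge_atTop 1] with n hrad hn u ⟨hu, hac, hlt⟩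
  have hP := hM.alternative_mem n hn
  refine lt_of_le_of_lt ((abs_powerSum_sub_le_of_lt_one h0 h1 hu hP (hM.null_mem n hn)).trans ?_)
    hηε
  have h2 := sum_abs_sub_le hη0.le hu hP (hbad _ u (P n) hu hP hac)
  have h3 : powerDiv 1 u (P n) / c ≤ η := by
    rw [div_le_iff₀ hc0]; linarith
  have h4 : 0 ≤ ∑ j, |u j - P n j| := Finset.sum_nonneg fun _ _ => abs_nonneg _
  gcongr
  linarith

lemma abs_rpow_sub_rpow_le_of_abs_sub_le {x y η α : ℝ} (hα : 1 < α) (hx : 0 ≤ x) (hy : 0 ≤ y)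
    (h0 : 0 < η) (h1 : η < 1) (h : |x - y| ≤ η * y) :
    |x ^ α - y ^ α| ≤ ((1 + η) ^ α - (1 - η) ^ α) * y ^ α := by
  obtain ⟨h2, h3⟩ := abs_le.1 h
  have h4 : x ^ α ≤ (1 + η) ^ α * y ^ α := by
    rw [← Real.mul_rpow (by linarith) hy]
    exact Real.rpow_le_rpow hx (by linarith) (by linarith)
  have h5 : (1 - η) ^ α * y ^ α ≤ x ^ α := by
    rw [← Real.mul_rpow (by linarith) hy]
    exact Real.rpow_le_rpow (mul_nonneg (by linarith) hy) (by linarith) (by linarith)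
  have h6 : 1 ≤ (1 + η) ^ α := Real.one_le_rpow (by linarith) (by linarith)
  have h7 : (1 - η) ^ α ≤ 1 := Real.rpow_le_one (by linarith) (by linarith) (by linarith)
  have h8 : 0 ≤ y ^ α := Real.rpow_nonneg hy α
  rw [abs_le]
  constructor <;> nlinarith

/-- Cells with small relative deviation change their powers by a small factor. On the others
superadditivity of `t^α` bounds everything by `b^α`, which the uniform weights multiply by
`K^(α-1)`. -/
lemma abs_powerSum_sub_le_of_one_lt {K : ℕ} {u v q : Fin K → ℝ} {α η b : ℝ} (hα : 1 < α)
    (h0 : 0 < η) (h1 : η < 1) (hu : u ∈ stdSimplex ℝ (Fin K)) (hv : v ∈ stdSimplex ℝ (Fin K))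
    (hq : ∀ j, q j = 1 / K) (h : ∑ j with η * v j < |u j - v j|, max (u j) (v j) ≤ b) :
    |powerSum α u q - powerSum α v q| ≤
      ((1 + η) ^ α - (1 - η) ^ α) * powerSum α v q + ((K : ℝ) ^ (1 - 1 / α) * b) ^ α := by
  have hα0 : 0 < α := by linarith
  have hmax : ∀ j, 0 ≤ max (u j) (v j) := fun j => (hu.1 j).trans (le_max_left _ _)
  have hb : 0 ≤ b := le_trans (Finset.sum_nonneg fun j _ => hmax j) h
  have hqα : ∀ j, q j ^ (1 - α) = (K : ℝ) ^ (α - 1) := fun j => by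
    rw [hq, one_div, Real.inv_rpow (by positivity), ← Real.rpow_neg (by positivity), neg_sub]
  have hKα : 0 ≤ (K : ℝ) ^ (α - 1) := by positivity
  have hκ : 0 ≤ (1 + η) ^ α - (1 - η) ^ α :=
    sub_nonneg.2 (Real.rpow_le_rpow (by linarith) (by linarith) hα0.le)
  have hpow : ((K : ℝ) ^ (1 - 1 / α) * b) ^ α = b ^ α * (K : ℝ) ^ (α - 1) := by
    rw [Real.mul_rpow (by positivity) hb, ← Real.rpow_mul (by positivity), mul_comm]
    congr 2
    field_simp
  simp only [powerSum, hqα, ← Finset.sum_mul]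
  rw [hpow, ← sub_mul, abs_mul, abs_of_nonneg hKα, ← mul_assoc, ← add_mul]
  refine mul_le_mul_of_nonneg_right ?_ hKα
  rw [← Finset.sum_sub_distrib]
  refine (Finset.abs_sum_le_sum_abs _ _).trans ?_
  rw [← Finset.sum_filter_add_sum_filter_not Finset.univ (fun j => η * v j < |u j - v j|), add_comm]
  refine add_le_add ?_ ?_
  · rw [Finset.mul_sum]
    refine (Finset.sum_le_sum fun j hj => ?_).trans (Finset.sum_le_sum_of_subset_of_nonneg
      (Finset.filter_subset _ _) fun j _ _ => mul_nonneg hκ (Real.rpow_nonneg (hv.1 j) α))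
    exact abs_rpow_sub_rpow_le_of_abs_sub_le hα (hu.1 j) (hv.1 j) h0 h1
      (not_lt.1 (Finset.mem_filter.1 hj).2)
  · refine le_trans (Finset.sum_le_sum (g := fun j => max (u j) (v j) ^ α) fun j _ => ?_)
      ((sum_rpow_le_rpow_sum _ (fun j _ => hmax j) hα).trans
        (Real.rpow_le_rpow (Finset.sum_nonneg fun j _ => hmax j) h hα0.le))
    have h2 := Real.rpow_nonneg (hu.1 j) α
    have h3 := Real.rpow_nonneg (hv.1 j) α
    have h4 := Real.rpow_le_rpow (hu.1 j) (le_max_left (u j) (v j)) hα0.le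
    have h5 := Real.rpow_le_rpow (hv.1 j) (le_max_right (u j) (v j)) hα0.le
    rw [abs_le]
    constructor <;> linarith

lemma tendsto_statistic_alternative_of_one_lt (hM : CellModel k P Q)
    (hU : ∀ n, 1 ≤ n → ∀ j, Q n j = 1 / (k n : ℝ)) {α Δ : ℝ} (hα : 1 < α)
    (hI : Identifiable k P Q α Δ)
    (hk : Tendsto (fun n : ℕ => (k n : ℝ) ^ (2 - 1 / α) * Real.log n / n) atTop (𝓝 0))
    {ε : ℝ} (hε : 0 < ε) :
    Tendsto (fun n => (sampleLaw (P n) n).real {ω | ε ≤ |statistic α (Q n) ω - Δ|})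
      atTop (𝓝 0) := by
  have hα0 : 0 < α := by linarith
  refine tendsto_statistic_alternative hM (fun ε hε => ?_) hε
  have := abs_powerDiv_sub_lt_of_powerSum hα0.ne' hα.ne' hI (R := fun n u =>
    u ∈ stdSimplex ℝ (Fin (k n)) ∧ (∀ j, P n j = 0 → u j = 0) ∧
      powerDiv 1 u (P n) < typeRadius (k n) n) ?_ ε hε
  · filter_upwards [this] with n h u hu hac hlt using h u ⟨hu, hac, hlt⟩
  intro ε hε
  set M := 1 + α * (α - 1) * Δ with hMdef
  have hM0 : 0 < M := by
    have := mul_pos (mul_pos hα0 (sub_pos.2 hα)) hI.pos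
    linarith
  have hS := (tendsto_powerSum hI hα0.ne' hα.ne').eventually (gt_mem_nhds (lt_add_one M))
  have hc : Tendsto (fun η : ℝ => ((1 + η) ^ α - (1 - η) ^ α) * (M + 1)) (𝓝[>] 0) (𝓝 0) := by
    have : ContinuousAt (fun η : ℝ => ((1 + η) ^ α - (1 - η) ^ α) * (M + 1)) 0 :=
      ((((continuousAt_const (y := (1 : ℝ))).add continuousAt_id).rpow_const (Or.inr hα0.le)).sub
        (((continuousAt_const (y := (1 : ℝ))).sub continuousAt_id).rpow_const
          (Or.inr hα0.le))).mul continuousAt_const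
    have h := this.tendsto.mono_left (nhdsWithin_le_nhds (s := Set.Ioi 0))
    simpa using h
  obtain ⟨η, hηε, hη0, hη1⟩ :=
    ((hc.eventually (gt_mem_nhds (half_pos hε))).and (Ioo_mem_nhdsGT one_pos)).exists
  obtain ⟨c, hc0, hbad⟩ := exists_sum_max_le_klDiv hη0 hη1
  have hrad : Tendsto (fun n => ((k n : ℝ) ^ (1 - 1 / α) * (typeRadius (k n) n / c)) ^ α) atTop
      (𝓝 0) := by
    have h1 := ((tendsto_peak_condition hα hk).const_mul (2 / c)).rpow_const (p := α)
      (Or.inr hα0.le)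
    rw [mul_zero, Real.zero_rpow hα0.ne'] at h1
    refine h1.congr fun n => ?_
    congr 1
    unfold typeRadius
    ring
  filter_upwards [hrad.eventually (gt_mem_nhds (half_pos hε)), hS, eventually_ge_atTop 1]
    with n hrad hS hn u ⟨hu, hac, hlt⟩
  have hP := hM.alternative_mem n hn
  have h1 := abs_powerSum_sub_le_of_one_lt hα hη0 hη1 hu hP (hU n hn)
    ((hbad _ u (P n) hu hP hac).trans (div_le_div_of_nonneg_right hlt.le hc0.le))
  have hκ : 0 ≤ (1 + η) ^ α - (1 - η) ^ α :=
    sub_nonneg.2 (Real.rpow_le_rpow (by linarith) (by linarith) hα0.le)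
  have h2 := mul_le_mul_of_nonneg_left hS.le hκ
  linarith

/-- If `x ≥ y`, the logarithm is at most `-log y`. If `x ≤ y`, then `|log t| √t < 2` for `t = x/y ≤
1` gives `4y`. -/
lemma mul_sq_log_div_le {x y L : ℝ} (hx : 0 ≤ x) (hx1 : x ≤ 1) (hy : 0 < y)
    (hL : -Real.log y ≤ L) : x * Real.log (x / y) ^ 2 ≤ x * L ^ 2 + 4 * y := by
  rcases hx.eq_or_lt with rfl | hx
  · simp; linarith
  have hr : 0 < x / y := div_pos hx hy
  rcases le_total y x with h | h
  · have h1 : 0 ≤ Real.log (x / y) := Real.log_nonneg ((one_le_div hy).2 h)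
    have h2 : Real.log (x / y) ≤ L := by
      rw [Real.log_div hx.ne' hy.ne']
      linarith [Real.log_nonpos hx.le hx1]
    have : x * Real.log (x / y) ^ 2 ≤ x * L ^ 2 := by gcongr
    linarith
  · have h1 := Real.abs_log_mul_self_rpow_lt (x / y) (1 / 2) hr ((div_le_one hy).2 h) (by norm_num)
    have h2 := pow_lt_pow_left₀ h1 (abs_nonneg _) two_ne_zero
    rw [sq_abs, mul_pow, ← Real.sqrt_eq_rpow, Real.sq_sqrt hr.le] at h2
    have h3 : x * Real.log (x / y) ^ 2 = y * (Real.log (x / y) ^ 2 * (x / y)) := by field_simp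
    have h4 : 0 ≤ x * L ^ 2 := by positivity
    rw [h3]
    nlinarith

/-- By `klDiv_eq_add` the error splits into the divergence from `P n`, small by types, and the
fluctuation of a mean log-likelihood ratio, handled by Chebyshev's inequality: as `q > ρ/k ≥ ρ/n`,
its second moment is at most `log²(n/ρ) + 4`. -/
lemma tendsto_statistic_alternative_one (hM : CellModel k P Q) (hR : RegularNull k Q) {Δ : ℝ}
    (hI : Identifiable k P Q 1 Δ)
    (hk : Tendsto (fun n : ℕ => (k n : ℝ) * Real.log n / n) atTop (𝓝 0)) {ε : ℝ} (hε : 0 < ε) :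
    Tendsto (fun n => (sampleLaw (P n) n).real {ω | ε ≤ |statistic 1 (Q n) ω - Δ|})
      atTop (𝓝 0) := by
  obtain ⟨ρ, hρ, hlow⟩ := hR.lower_bound
  let f : (n : ℕ) → Fin (k n) → ℝ := fun n j => Real.log (P n j / Q n j)
  let V : (n : ℕ) → Set (Fin n → Fin (k n)) := fun n =>
    {ω | ε / 4 ≤ |∑ j, empirical ω j * f n j - ∑ j, P n j * f n j|}
  have hV : Tendsto (fun n => (sampleLaw (P n) n).real (V n)) atTop (𝓝 0) := by
    have hlim : Tendsto (fun n : ℕ => (Real.log (n / ρ) ^ 2 + 4) / (n * (ε / 4) ^ 2)) atTop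
        (𝓝 0) := by
      have hx : Tendsto (fun n : ℕ => (n : ℝ) / ρ) atTop atTop :=
        tendsto_natCast_atTop_atTop.atTop_div_const hρ
      have h1 := (Real.isLittleO_pow_log_id_atTop (n := 2)).tendsto_div_nhds_zero.comp hx
      have h2 : Tendsto (fun n : ℕ => 4 / ((n : ℝ) / ρ)) atTop (𝓝 0) :=
        tendsto_const_nhds.div_atTop hx
      have h3 := (h1.add h2).const_mul (1 / (ρ * (ε / 4) ^ 2))
      rw [add_zero, mul_zero] at h3
      refine h3.congr' ?_
      filter_upwards [eventually_ge_atTop 1] with n hn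
      have hn0 : (0 : ℝ) < n := by exact_mod_cast hn
      simp only [Function.comp_apply, id]
      field_simp
    refine squeeze_zero' (Eventually.of_forall fun n => measureReal_nonneg) ?_ hlim
    filter_upwards [eventually_ge_atTop 1, hM.card_tendsto.eventually_ge_atTop 1] with n hn hkn
    have hn0 : (0 : ℝ) < n := by exact_mod_cast hn
    have hk0 : (0 : ℝ) < k n := by exact_mod_cast hkn
    have hP := hM.alternative_mem n hn
    refine (sampleLaw_sum_empirical_ge_le hn hP (f n) (by positivity : 0 < ε / 4)).trans ?_
    gcongr
    calc _ ≤ ∑ j, (P n j * Real.log (n / ρ) ^ 2 + 4 * Q n j) := by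
          refine Finset.sum_le_sum fun j _ => ?_
          have hQj := hR.pos hn j
          refine mul_sq_log_div_le (hP.1 j) ?_ hQj ?_
          · rw [← hP.2]
            exact Finset.single_le_sum (fun i _ => hP.1 i) (Finset.mem_univ j)
          · rw [← Real.log_inv]
            refine Real.log_le_log (by positivity) ?_
            rw [inv_le_comm₀ hQj (by positivity), inv_div]
            refine le_trans ?_ (hlow n hn j).le
            have : (k n : ℝ) ≤ n := by exact_mod_cast hM.card_le n
            gcongr
      _ = _ := by
          rw [Finset.sum_add_distrib, ← Finset.sum_mul, ← Finset.mul_sum, hP.2,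
            (hM.null_mem n hn).2]
          ring
  have hsum := (tendsto_klDiv_empirical hM).add hV
  rw [add_zero] at hsum
  refine squeeze_zero' (Eventually.of_forall fun n => measureReal_nonneg) ?_ hsum
  filter_upwards [eventually_ge_atTop 1,
    (tendsto_typeRadius hk).eventually (gt_mem_nhds (by positivity : 0 < ε / 4)),
    (Metric.tendsto_nhds.1 hI.tendsto) (ε / 4) (by positivity)] with n hn hrad hD
  have hP := hM.alternative_mem n hn
  have := isProbabilityMeasure_sampleLaw hP n
  refine le_trans (sampleLaw_real_le_of_ac hP fun ω hω hac => ?_) (measureReal_union_le _ _)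
  by_contra hnot
  rw [Set.mem_union, not_or] at hnot
  have h1 : powerDiv 1 (empirical ω) (P n) < typeRadius (k n) n := not_le.1 hnot.1
  have h2 : |∑ j, empirical ω j * f n j - ∑ j, P n j * f n j| < ε / 4 := not_le.1 hnot.2
  have h3 := klDiv_eq_add hac (hR.pos hn)
  have h4 : 0 ≤ powerDiv 1 (empirical ω) (P n) :=
    klDiv_nonneg (empirical_mem hn ω) hP hac
  rw [Real.dist_eq] at hD
  have h5 : powerDiv 1 (P n) (Q n) = ∑ j, P n j * f n j := by rw [powerDiv, if_pos rfl]
  rw [h5] at hD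
  have h6 : ε ≤ |powerDiv 1 (empirical ω) (Q n) - Δ| := hω
  rw [h3] at h6
  rw [abs_lt] at h2 hD
  change ε ≤ |powerDiv 1 (empirical ω) (P n) + ∑ j, empirical ω j * f n j - Δ| at h6
  refine absurd h6 (not_le.2 (abs_lt.2 ⟨by linarith, by linarith⟩))

end Consistency

end PowerDivergence

namespace PowerDivergence

/-! ### Existence, value and uniqueness of the efficiency. -/

section Efficiency

variable {k : ℕ → ℕ} {P Q : (n : ℕ) → Fin (k n) → ℝ} {α₁ α₂ Δ₁ Δ₂ : ℝ}

lemma mem_levels_of_lt_one (hA : Assumptions k P Q α₁ α₂ Δ₁ Δ₂) (h0 : 0 < α₁) (h : α₁ < α₂)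
    (h1 : α₂ < 1) (hΔ : 0 < 1 + α₂ * (α₂ - 1) * Δ₂) : Δ₁ ∈ levels α₁ := by
  refine ⟨hA.identifiable₁.pos, ?_⟩
  have hα₁ : α₁ < 1 := h.trans h1
  have hθ : 0 < (1 - α₂) / (1 - α₁) := div_pos (by linarith) (by linarith)
  have hS₁ := tendsto_powerSum hA.identifiable₁ h0.ne' hα₁.ne
  have hS₂ := tendsto_powerSum hA.identifiable₂ (h0.trans h).ne' h1.ne
  have hle : 1 + α₂ * (α₂ - 1) * Δ₂ ≤ (1 + α₁ * (α₁ - 1) * Δ₁) ^ ((1 - α₂) / (1 - α₁)) := by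
    refine le_of_tendsto_of_tendsto hS₂ (hS₁.rpow_const (Or.inr hθ.le)) ?_
    filter_upwards [eventually_ge_atTop 1] with n hn
    exact powerSum_rpow_le (hA.model.alternative_mem n hn) (hA.regular.pos hn) h0 h h1
  have hnn : 0 ≤ 1 + α₁ * (α₁ - 1) * Δ₁ := by
    refine ge_of_tendsto hS₁ ?_
    filter_upwards [eventually_ge_atTop 1] with n hn
    exact powerSum_nonneg (hA.model.alternative_mem n hn).1 (hA.model.null_mem n hn).1
  refine lt_of_le_of_ne hnn fun h2 => ?_
  rw [← h2, Real.zero_rpow hθ.ne'] at hle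
  linarith

/-- For `α₁ < 1` the power sum of order `α₁` is at least `exp((α₁-1) D_1)`, and `D_1 ≤ α₂ D_α₂`
stays bounded, so the limit is positive. -/
lemma mem_levels_of_one_le (hA : Assumptions k P Q α₁ α₂ Δ₁ Δ₂) (h0 : 0 < α₁) (h1 : 1 ≤ α₂) :
    Δ₁ ∈ levels α₁ := by
  rcases le_or_gt 1 α₁ with hα₁ | hα₁
  · exact levels_of_one_lt hα₁ hA.identifiable₁.pos
  refine ⟨hA.identifiable₁.pos, lt_of_lt_of_le (Real.exp_pos ((α₁ - 1) * (α₂ * Δ₂))) ?_⟩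
  refine le_of_tendsto_of_tendsto
    (((hA.identifiable₂.tendsto.const_mul α₂).const_mul (α₁ - 1)).rexp)
    (tendsto_powerSum hA.identifiable₁ h0.ne' hα₁.ne) ?_
  filter_upwards [eventually_ge_atTop 1] with n hn
  have hP := hA.model.alternative_mem n hn
  have hQ := hA.regular.pos hn
  refine le_trans (Real.exp_le_exp.2 ?_) (exp_mul_klDiv_le_powerSum hP hQ α₁)
  refine mul_le_mul_of_nonpos_left ?_ (by linarith)
  rcases h1.eq_or_lt with rfl | h1
  · rw [one_mul]
  · exact klDiv_le_mul_powerDiv h1 hP hQ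

/-- Dividing the two limit relations at the same level cancels the error probability. -/
lemma tendsto_generator_div {α x : ℝ} {g g' : ℝ → ℝ} {c c' : ℕ → ℝ}
    (h : IsBahadurFunction k Q α g c) (h' : IsBahadurFunction k Q α g' c') (hx : x ∈ levels α) :
    Tendsto (fun n => c n / c' n) atTop (𝓝 (g x / g' x)) := by
  refine ((h.tendsto x hx).div (h'.tendsto x hx) (h'.pos x hx).ne').congr' ?_
  filter_upwards [(h'.tendsto x hx).eventually (lt_mem_nhds (h'.pos x hx)),
    eventually_ge_atTop 1, h'.generator_pos] with n h1 h2 h3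
  have hn0 : (n : ℝ) ≠ 0 := by positivity
  have hlog : Real.log (errorProb k Q α n x) ≠ 0 := fun h => by simp [h] at h1
  simp only [Pi.div_apply]
  field_simp

/-- A Bahadur efficiency can be computed with any given pair of Bahadur functions. -/
lemma IsBahadurEfficiency.exists_of_isBahadurFunction {B : ENNReal}
    (hB : IsBahadurEfficiency k P Q α₁ α₂ Δ₁ Δ₂ B) {g₁ g₂ : ℝ → ℝ} {c₁ c₂ : ℕ → ℝ}
    (h₁ : IsBahadurFunction k Q α₁ g₁ c₁) (h₂ : IsBahadurFunction k Q α₂ g₂ c₂) :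
    ∃ (m : ℕ → ℕ) (c : ENNReal), Tendsto m atTop atTop ∧
      (fun n => (m n : ℝ) / c₂ (m n)) ~[atTop] (fun n => g₁ Δ₁ / g₂ Δ₂ * ((n : ℝ) / c₁ n)) ∧
      Tendsto (fun n => ENNReal.ofReal (c₂ (m n) / c₁ n)) atTop (𝓝 c) ∧
      B = ENNReal.ofReal (g₁ Δ₁ / g₂ Δ₂) * c := by
  obtain ⟨-, -, hΔ₁, hΔ₂, g₁', g₂', c₁', c₂', m, c, h₁', h₂', hm, heq, hc, hBc⟩ := hB
  have p₁ := h₁.pos _ hΔ₁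
  have p₂ := h₂.pos _ hΔ₂
  have p₁' := h₁'.pos _ hΔ₁
  have p₂' := h₂'.pos _ hΔ₂
  refine ⟨m, ENNReal.ofReal (g₂ Δ₂ / g₂' Δ₂ * (g₁' Δ₁ / g₁ Δ₁)) * c, hm, ?_, ?_, ?_⟩
  · have e₂ : (fun n => c₂' (m n) / c₂ (m n)) ~[atTop] fun _ => g₂' Δ₂ / g₂ Δ₂ :=
      (isEquivalent_const_iff_tendsto (by positivity)).2
        ((tendsto_generator_div h₂' h₂ hΔ₂).comp hm)
    have e₁ : (fun n => c₁ n / c₁' n) ~[atTop] fun _ => g₁ Δ₁ / g₁' Δ₁ :=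
      (isEquivalent_const_iff_tendsto (by positivity)).2 (tendsto_generator_div h₁ h₁' hΔ₁)
    have e₀ : (fun n : ℕ => (n : ℝ) / c₁ n) ~[atTop] fun n : ℕ => (n : ℝ) / c₁ n :=
      IsEquivalent.refl
    have hl : (fun n => (m n : ℝ) / c₂' (m n) * (c₂' (m n) / c₂ (m n))) =ᶠ[atTop]
        fun n => (m n : ℝ) / c₂ (m n) := by
      filter_upwards [hm.eventually h₂'.generator_pos] with n hn
      field_simp
    have hr : (fun n : ℕ => g₁' Δ₁ / g₂' Δ₂ * ((n : ℝ) / c₁' n) * (g₂' Δ₂ / g₂ Δ₂)) =ᶠ[atTop]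
        fun n : ℕ => g₁' Δ₁ / g₂ Δ₂ * (n / c₁ n * (c₁ n / c₁' n)) := by
      filter_upwards [h₁.generator_pos] with n hn
      field_simp
    have hconst : (fun n : ℕ => g₁' Δ₁ / g₂ Δ₂ * ((n : ℝ) / c₁ n * (g₁ Δ₁ / g₁' Δ₁))) =
        fun n : ℕ => g₁ Δ₁ / g₂ Δ₂ * ((n : ℝ) / c₁ n) := by
      funext n
      field_simp
    have hk := (IsEquivalent.refl (u := fun _ : ℕ => g₁' Δ₁ / g₂ Δ₂) (l := atTop)).mul (e₀.mul e₁)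
    have hk' : (fun n : ℕ => g₁' Δ₁ / g₂ Δ₂ * ((n : ℝ) / c₁ n * (c₁ n / c₁' n))) ~[atTop]
        fun n : ℕ => g₁ Δ₁ / g₂ Δ₂ * ((n : ℝ) / c₁ n) := by
      rw [← hconst]; exact hk
    exact (((heq.mul e₂).congr_left hl).congr_right hr).trans hk'
  · have t₂ := (tendsto_generator_div h₂ h₂' hΔ₂).comp hm
    have t₁ := tendsto_generator_div h₁' h₁ hΔ₁
    have t := ENNReal.Tendsto.mul (ENNReal.tendsto_ofReal (t₂.mul t₁))
      (Or.inl (by rw [ne_eq, ENNReal.ofReal_eq_zero, not_le]; positivity)) hc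
      (Or.inr ENNReal.ofReal_ne_top)
    refine t.congr' ?_
    filter_upwards [hm.eventually h₂'.generator_pos, hm.eventually h₂.generator_pos,
      h₁'.generator_pos, h₁.generator_pos] with n q₂' q₂ q₁' q₁
    simp only [Function.comp_apply]
    rw [← ENNReal.ofReal_mul (by positivity)]
    congr 1
    field_simp
  · rw [hBc, ← mul_assoc, ← ENNReal.ofReal_mul (by positivity)]
    congr 2
    field_simp

lemma isBahadurEfficiency_iff_of_le_one (hA : Assumptions k P Q α₁ α₂ Δ₁ Δ₂) (h0 : 0 < α₁)
    (h : α₁ < α₂) (h1 : α₂ ≤ 1) (hΔ₁ : Δ₁ ∈ levels α₁) (hΔ₂ : Δ₂ ∈ levels α₂)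
    (hk : Tendsto (fun n : ℕ => (k n : ℝ) * Real.log n / n) atTop (𝓝 0)) (B : ENNReal) :
    IsBahadurEfficiency k P Q α₁ α₂ Δ₁ Δ₂ B ↔
      B = ENNReal.ofReal (renyiLevel α₁ Δ₁ / renyiLevel α₂ Δ₂) := by
  have hα₂ : 0 < α₂ := h0.trans h
  have hα₁ : α₁ < 1 := h.trans_le h1
  have g₁ := isBahadurFunction_renyiLevel hA.model hA.regular hk h0 hα₁.le
  have g₂ := isBahadurFunction_renyiLevel hA.model hA.regular hk hα₂ h1
  constructor
  · intro hB
    obtain ⟨m, c, -, -, hc, rfl⟩ := hB.exists_of_isBahadurFunction g₁ g₂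
    have : c = 1 := tendsto_nhds_unique hc (by simp)
    rw [this, mul_one]
  · rintro rfl
    have hinv : Tendsto (fun n : ℕ => (1 : ℝ) / n) atTop (𝓝 0) := tendsto_one_div_atTop_nhds_zero_nat
    have p₁ := g₁.pos _ hΔ₁
    have p₂ := g₂.pos _ hΔ₂
    set r := renyiLevel α₁ Δ₁ / renyiLevel α₂ Δ₂ with hr
    have hr0 : 0 < r := div_pos p₁ p₂
    have hrn : Tendsto (fun n : ℕ => r * (n : ℝ)) atTop atTop :=
      tendsto_natCast_atTop_atTop.const_mul_atTop hr0
    refine ⟨⟨fun ε hε => tendsto_statistic_alternative_of_lt_one hA.model h0 hα₁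
        hA.identifiable₁ hk hε, fun ε hε => tendsto_statistic_null hA.model hA.regular h0 g₁ hinv hε⟩,
      ⟨fun ε hε => ?_, fun ε hε => tendsto_statistic_null hA.model hA.regular hα₂ g₂ hinv hε⟩,
      hΔ₁, hΔ₂, _, _, _, _, fun n => ⌈r * n⌉₊, 1, g₁, g₂, ?_, ?_, by simp, by rw [mul_one]⟩
    · rcases h1.eq_or_lt with rfl | h1
      · exact tendsto_statistic_alternative_one hA.model hA.regular hA.identifiable₂ hk hε
      · exact tendsto_statistic_alternative_of_lt_one hA.model hα₂ h1 hA.identifiable₂ hk hε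
    · exact tendsto_nat_ceil_atTop.comp hrn
    · simp only [div_one]
      exact isEquivalent_nat_ceil.comp_tendsto hrn

lemma eventually_peakRate_mono {α : ℝ} (hα : 1 < α) :
    ∃ K₀ : ℕ, ∀ K L : ℕ, K₀ ≤ K → K ≤ L → 0 < peakRate α K ∧ peakRate α K ≤ peakRate α L := by
  have hβ := one_sub_one_div_pos hα
  obtain ⟨K₀, hK₀⟩ := exists_nat_ge (Real.exp (1 - 1 / α)⁻¹)
  refine ⟨K₀, fun K L hK hL => ?_⟩
  have hK' : Real.exp (1 - 1 / α)⁻¹ ≤ K := hK₀.trans (by exact_mod_cast hK)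
  have hKL : (K : ℝ) ≤ L := by exact_mod_cast hL
  have h1 : (1 : ℝ) < K := lt_of_lt_of_le (Real.one_lt_exp_iff.2 (inv_pos.2 hβ)) hK'
  have hlogL : 0 < Real.log L := Real.log_pos (h1.trans_le hKL)
  have hlogK : 0 < Real.log K := Real.log_pos h1
  have h2 := Real.log_div_self_rpow_antitoneOn hβ hK' (hK'.trans hKL : _) hKL
  have hL0 : (0 : ℝ) < L := by linarith
  have hK0 : (0 : ℝ) < K := by linarith
  refine ⟨div_pos (by positivity) hlogK, ?_⟩
  have h3 := inv_anti₀ (div_pos hlogL (by positivity)) h2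
  rwa [inv_div, inv_div] at h3

/-- Sample sizes at which a slowly varying growth attains prescribed values asymptotically. -/
lemma exists_sampleSize {c y : ℕ → ℝ} (N : ℕ)
    (hc : ∀ m l, N ≤ m → m ≤ l → 0 < c m ∧ c m ≤ c l)
    (hcn : Tendsto (fun n : ℕ => c n / n) atTop (𝓝 0))
    (hy : ∀ᶠ n : ℕ in atTop, (n : ℝ) / c n < y n) :
    ∃ m : ℕ → ℕ, (∀ n, n ≤ m n) ∧ (fun n => (m n : ℝ) / c (m n)) ~[atTop] y := by
  have hf : Tendsto (fun n : ℕ => (n : ℝ) / c n) atTop atTop := by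
    have : Tendsto (fun n : ℕ => c n / n) atTop (𝓝[>] 0) := by
      refine tendsto_nhdsWithin_iff.2 ⟨hcn, ?_⟩
      filter_upwards [eventually_ge_atTop 1, eventually_ge_atTop N] with n h1 h2
      exact div_pos (hc n n h2 le_rfl).1 (by exact_mod_cast h1)
    refine this.inv_tendsto_nhdsGT_zero.congr fun n => ?_
    simp
  have hex : ∀ n, ∃ m, n ≤ m ∧ y n ≤ (m : ℝ) / c m := fun n =>
    ((eventually_ge_atTop n).and (hf.eventually_ge_atTop (y n))).exists
  classical
  -- The least `m ≥ n` with `m / c m ≥ y n`. Its predecessor `l` is still at least `n` and falls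
  -- short of `y n`, so monotonicity of `c` limits the overshoot to the factor `1 + 1/l`.
  refine ⟨fun n => Nat.find (hex n), fun n => (Nat.find_spec (hex n)).1, ?_⟩
  have hpos : ∀ᶠ n in atTop, 0 < y n := by
    filter_upwards [hy, hf.eventually_gt_atTop 0] with n h1 h2 using h2.trans h1
  have hne : ∀ᶠ n in atTop, y n ≠ 0 := hpos.mono fun n h => h.ne'
  rw [isEquivalent_iff_tendsto_one hne]
  have hlim : Tendsto (fun n : ℕ => 1 + 1 / (n : ℝ)) atTop (𝓝 1) := by
    simpa using (tendsto_one_div_atTop_nhds_zero_nat (𝕜 := ℝ)).const_add 1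
  refine tendsto_of_tendsto_of_tendsto_of_le_of_le' tendsto_const_nhds hlim ?_ ?_
  · filter_upwards [hpos] with n hn
    simp only [Pi.div_apply]
    rw [le_div_iff₀ hn, one_mul]
    exact (Nat.find_spec (hex n)).2
  · filter_upwards [hpos, hy, eventually_ge_atTop 1, eventually_ge_atTop N] with n hn hyn hn1 hnN
    simp only [Pi.div_apply]
    rw [div_le_iff₀ hn]
    set m := Nat.find (hex n) with hm
    obtain ⟨hnm, hym⟩ := Nat.find_spec (hex n)
    rw [← hm] at hnm hym
    have hlt : n < m := lt_of_le_of_ne hnm fun h => by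
      rw [← h] at hym
      linarith
    obtain ⟨l, hl⟩ : ∃ l, m = l + 1 := ⟨m - 1, by omega⟩
    have hnl : n ≤ l := by omega
    have hmin := Nat.find_min (hex n) (m := l) (by rw [← hm]; omega)
    rw [not_and, not_le] at hmin
    have hly := hmin hnl
    obtain ⟨hcl, hclm⟩ := hc l m (hnN.trans hnl) (by omega)
    have hn0 : (0 : ℝ) < n := by exact_mod_cast hn1
    have hnl' : (n : ℝ) ≤ l := by exact_mod_cast hnl
    have hl0 : (0 : ℝ) < l := by linarith
    calc (m : ℝ) / c m ≤ m / c l := by gcongr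
      _ = (1 + 1 / l) * (l / c l) := by
          rw [hl]; push_cast; field_simp
      _ ≤ (1 + 1 / n) * y n := by gcongr

lemma tendsto_condition_of_le (hM : CellModel k P Q) {α α' : ℝ} (h1 : 1 ≤ α) (h : α ≤ α')
    (hk : Tendsto (fun n : ℕ => (k n : ℝ) ^ (2 - 1 / α') * Real.log n / n) atTop (𝓝 0)) :
    Tendsto (fun n : ℕ => (k n : ℝ) ^ (2 - 1 / α) * Real.log n / n) atTop (𝓝 0) := by
  refine squeeze_zero' (Eventually.of_forall fun n => ?_) ?_ hk
  · have := Real.log_natCast_nonneg n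
    positivity
  · filter_upwards [hM.card_tendsto.eventually_ge_atTop 1] with n hn
    have := Real.log_natCast_nonneg n
    have : (1 : ℝ) ≤ k n := by exact_mod_cast hn
    gcongr

lemma isConsistent_peak (hM : CellModel k P Q) (hR : RegularNull k Q)
    (hU : ∀ n, 1 ≤ n → ∀ j, Q n j = 1 / (k n : ℝ)) {α Δ : ℝ} (hα : 1 < α)
    (hI : Identifiable k P Q α Δ)
    (hk : Tendsto (fun n : ℕ => (k n : ℝ) ^ (2 - 1 / α) * Real.log n / n) atTop (𝓝 0)) :
    IsConsistent k P Q α Δ :=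
  ⟨fun _ hε => tendsto_statistic_alternative_of_one_lt hM hU hα hI hk hε, fun _ hε =>
    tendsto_statistic_null hM hR (by linarith) (isBahadurFunction_peakLevel hM hU hα hk)
      (tendsto_peakRate_div hM hα hk) hε⟩

/-- Treats `α₁ ≤ 1` and `α₁ > 1` together: either way the generator of the first statistic is of
smaller order than `peakRate α₂ (k n)`, in the second case by the factor `k^(1/α₁-1/α₂)`. -/
lemma exists_isBahadurFunction_of_lt (hA : Assumptions k P Q α₁ α₂ Δ₁ Δ₂) (h0 : 0 < α₁)
    (h : α₁ < α₂) (h1 : 1 < α₂) (hU : ∀ n, 1 ≤ n → ∀ j, Q n j = 1 / (k n : ℝ))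
    (hk : Tendsto (fun n : ℕ => (k n : ℝ) ^ (2 - 1 / α₂) * Real.log n / n) atTop (𝓝 0)) :
    ∃ (g : ℝ → ℝ) (c : ℕ → ℝ), IsBahadurFunction k Q α₁ g c ∧ IsConsistent k P Q α₁ Δ₁ ∧
      Tendsto (fun n => peakRate α₂ (k n) / c n) atTop atTop ∧ (α₁ ≤ 1 → c = fun _ => 1) := by
  have hM := hA.model
  rcases le_or_gt α₁ 1 with hα | hα
  · have hk1 : Tendsto (fun n : ℕ => (k n : ℝ) * Real.log n / n) atTop (𝓝 0) := by
      refine (tendsto_condition_of_le hM le_rfl h1.le hk).congr fun n => ?_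
      norm_num
    have g := isBahadurFunction_renyiLevel hM hA.regular hk1 h0 hα
    refine ⟨_, _, g, ⟨fun ε hε => ?_, fun ε hε => tendsto_statistic_null hM hA.regular h0 g
      tendsto_one_div_atTop_nhds_zero_nat hε⟩, ?_, fun _ => rfl⟩
    · rcases hα.eq_or_lt with rfl | hα
      · exact tendsto_statistic_alternative_one hM hA.regular hA.identifiable₁ hk1 hε
      · exact tendsto_statistic_alternative_of_lt_one hM h0 hα hA.identifiable₁ hk1 hε
    · simpa [Function.comp_def] using (tendsto_peakRate h1).comp hM.card_tendsto
  · have hk1 := tendsto_condition_of_le hM hα.le h.le hk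
    refine ⟨_, _, isBahadurFunction_peakLevel hM hU hα hk1,
      isConsistent_peak hM hA.regular hU hα hA.identifiable₁ hk1, ?_, fun h => absurd h (not_le.2 hα)⟩
    have hexp : 0 < 1 / α₁ - 1 / α₂ := sub_pos.2 (one_div_lt_one_div_of_lt h0 h)
    have hkR : Tendsto (fun n => (k n : ℝ)) atTop atTop :=
      tendsto_natCast_atTop_atTop.comp hM.card_tendsto
    refine ((tendsto_rpow_atTop hexp).comp hkR).congr' ?_
    filter_upwards [hkR.eventually_gt_atTop 1] with n hn
    have hk0 : (0 : ℝ) < k n := by linarith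
    have hlog := Real.log_pos hn
    simp only [Function.comp_apply, peakRate]
    rw [div_div_div_cancel_right₀ hlog.ne', ← Real.rpow_sub hk0]
    congr 1; ring

/-- Sample sizes `m n ≥ n` can be chosen since the second statistic has the slower exponent;
monotone generators then give `c₂(m n)/c₁(n) ≥ c₂(n)/c₁(n) → ∞`. -/
lemma isBahadurEfficiency_top (hA : Assumptions k P Q α₁ α₂ Δ₁ Δ₂) (h0 : 0 < α₁)
    (h : α₁ < α₂) (h1 : 1 < α₂) (hmono : Monotone k)
    (hU : ∀ n, 1 ≤ n → ∀ j, Q n j = 1 / (k n : ℝ))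
    (hk : Tendsto (fun n : ℕ => (k n : ℝ) ^ (2 - 1 / α₂) * Real.log n / n) atTop (𝓝 0)) :
    IsBahadurEfficiency k P Q α₁ α₂ Δ₁ Δ₂ ⊤ := by
  have hM := hA.model
  obtain ⟨g, c, hg, hcons, hdiv, -⟩ := exists_isBahadurFunction_of_lt hA h0 h h1 hU hk
  have g₂ := isBahadurFunction_peakLevel hM hU h1 hk
  have hΔ₁ := mem_levels_of_one_le hA h0 h1.le
  have hΔ₂ : Δ₂ ∈ levels α₂ := levels_of_one_lt h1.le hA.identifiable₂.pos
  have hr : 0 < g Δ₁ / peakLevel α₂ Δ₂ := div_pos (hg.pos _ hΔ₁) (g₂.pos _ hΔ₂)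
  obtain ⟨K₀, hK₀⟩ := eventually_peakRate_mono h1
  obtain ⟨N, hN⟩ := eventually_atTop.1 (hM.card_tendsto.eventually_ge_atTop K₀)
  have hc₂ : ∀ m l, N ≤ m → m ≤ l →
      0 < peakRate α₂ (k m) ∧ peakRate α₂ (k m) ≤ peakRate α₂ (k l) :=
    fun m l hm hl => hK₀ _ _ (hN m hm) (hmono hl)
  obtain ⟨m, hnm, heq⟩ := exists_sampleSize (c := fun n => peakRate α₂ (k n))
    (y := fun n : ℕ => g Δ₁ / peakLevel α₂ Δ₂ * ((n : ℝ) / c n)) N hc₂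
    (tendsto_peakRate_div hM h1 hk) (by
      filter_upwards [(hdiv.const_mul_atTop hr).eventually_gt_atTop 1, hg.generator_pos,
        eventually_ge_atTop 1, eventually_ge_atTop N] with n h2 h3 h4 h5
      have h6 := (hc₂ n n h5 le_rfl).1
      have hn0 : (0 : ℝ) < n := by exact_mod_cast h4
      have h7 := mul_lt_mul_of_pos_right h2 (div_pos hn0 h6)
      rw [one_mul] at h7
      refine h7.trans_eq ?_
      field_simp)
  have hm : Tendsto m atTop atTop := tendsto_atTop_mono hnm tendsto_id
  refine ⟨hcons, isConsistent_peak hM hA.regular hU h1 hA.identifiable₂ hk, hΔ₁, hΔ₂, g, _, c, _,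
    m, ⊤, hg, g₂, hm, heq, ?_, ?_⟩
  · refine ENNReal.tendsto_ofReal_atTop.comp (tendsto_atTop_mono' _ ?_ hdiv)
    filter_upwards [eventually_ge_atTop N, hg.generator_pos] with n h2 h3
    have := (hc₂ n (m n) h2 (hnm n)).2
    gcongr
  · rw [ENNReal.mul_top]
    rw [ne_eq, ENNReal.ofReal_eq_zero, not_le]
    exact hr

lemma div_peakRate_le {α C : ℝ} (hα : 1 < α) {m n : ℕ} (hm : 1 ≤ m) (hmn : m ≤ n) {K L : ℕ}
    (hK : 2 ≤ K) (hKL : K ≤ L) (h : (m : ℝ) * L ≤ C * (n * K)) :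
    (m : ℝ) / peakRate α K ≤ C ^ (1 - 1 / α) * (n / peakRate α L) := by
  have hβ := one_sub_one_div_pos hα
  have hm0 : (0 : ℝ) < m := by exact_mod_cast hm
  have hn0 : (0 : ℝ) < n := by exact_mod_cast hm.trans hmn
  have hK0 : (0 : ℝ) < K := by positivity
  have hL0 : (0 : ℝ) < L := by exact_mod_cast (by omega : 0 < L)
  have hC : 0 < C := by
    refine pos_of_mul_pos_left (lt_of_lt_of_le (by positivity) h) (by positivity)
  have hlogK : 0 < Real.log K := Real.log_pos (by exact_mod_cast (by omega : 1 < K))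
  have hlog : Real.log K ≤ Real.log L := Real.log_le_log hK0 (by exact_mod_cast hKL)
  -- In this factorisation `a^(1/α)` and `log M` are monotone, and only `a/M` needs the regularity
  -- of `k`.
  have key : ∀ (a : ℝ) (M : ℕ), 0 < a → (0 : ℝ) < M →
      a / peakRate α M = a ^ (1 / α) * Real.log M * (a / M) ^ (1 - 1 / α) := by
    intro a M ha hM
    have : a ^ (1 / α) * a ^ (1 - 1 / α) = a := by
      rw [← Real.rpow_add ha]; simp
    rw [Real.div_rpow ha.le hM.le, peakRate]
    conv_lhs => rw [← this]
    field_simp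
  rw [key m K hm0 hK0, key n L hn0 hL0]
  have h2 : (m : ℝ) / K ≤ C * (n / L) := by
    rw [mul_div_assoc', div_le_div_iff₀ hK0 hL0]
    linarith
  calc _ ≤ (n : ℝ) ^ (1 / α) * Real.log L * (C * (n / L)) ^ (1 - 1 / α) := by
        have : (m : ℝ) ≤ n := by exact_mod_cast hmn
        have : 0 ≤ 1 / α := by positivity
        gcongr
    _ = _ := by
        rw [Real.mul_rpow hC.le (by positivity)]
        ring

lemma IsBahadurEfficiency.eq_top (hA : Assumptions k P Q α₁ α₂ Δ₁ Δ₂) (h0 : 0 < α₁)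
    (h : α₁ < α₂) (h1 : 1 < α₂) (hmono : Monotone k)
    (hU : ∀ n, 1 ≤ n → ∀ j, Q n j = 1 / (k n : ℝ))
    (hk : Tendsto (fun n : ℕ => (k n : ℝ) ^ (2 - 1 / α₂) * Real.log n / n) atTop (𝓝 0))
    (hC : α₁ ≤ 1 ∨ ∃ C : ℝ, ∀ m n : ℕ, m ≤ n → (m : ℝ) * k n ≤ C * ((n : ℝ) * k m))
    {B : ENNReal} (hB : IsBahadurEfficiency k P Q α₁ α₂ Δ₁ Δ₂ B) : B = ⊤ := by
  have hM := hA.model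
  obtain ⟨g, c, hg, -, hdiv, hone⟩ := exists_isBahadurFunction_of_lt hA h0 h h1 hU hk
  have g₂ := isBahadurFunction_peakLevel hM hU h1 hk
  have hΔ₁ := mem_levels_of_one_le hA h0 h1.le
  have hΔ₂ : Δ₂ ∈ levels α₂ := levels_of_one_lt h1.le hA.identifiable₂.pos
  have hr : 0 < g Δ₁ / peakLevel α₂ Δ₂ := div_pos (hg.pos _ hΔ₁) (g₂.pos _ hΔ₂)
  obtain ⟨m, c', hm, heq, hc', rfl⟩ := hB.exists_of_isBahadurFunction hg g₂
  suffices ht : Tendsto (fun n => peakRate α₂ (k (m n)) / c n) atTop atTop by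
    rw [tendsto_nhds_unique hc' (ENNReal.tendsto_ofReal_atTop.comp ht), ENNReal.mul_top]
    rw [ne_eq, ENNReal.ofReal_eq_zero, not_le]
    exact hr
  rcases hC with hα | ⟨C, hC⟩
  · rw [hone hα]
    simpa [Function.comp_def] using (tendsto_peakRate h1).comp (hM.card_tendsto.comp hm)
  obtain ⟨K₀, hK₀⟩ := eventually_peakRate_mono h1
  -- If `m n < n`, regularity would bound `m/c₂(m)` by a constant times `n/c₂(n)`, which is of
  -- smaller order than the required `n/c₁(n)`.
  have hnm : ∀ᶠ n in atTop, n ≤ m n := by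
    set r := g Δ₁ / peakLevel α₂ Δ₂
    have hne : ∀ᶠ n : ℕ in atTop, r * ((n : ℝ) / c n) ≠ 0 := by
      filter_upwards [hg.generator_pos, eventually_ge_atTop 1] with n h2 h3
      positivity
    have hlim := (isEquivalent_iff_tendsto_one hne).1 heq
    have hsmall := (hdiv.const_mul_atTop hr).eventually_gt_atTop (2 * C ^ (1 - 1 / α₂))
    filter_upwards [hlim.eventually (lt_mem_nhds (by norm_num : (1 / 2 : ℝ) < 1)), hsmall,
      hg.generator_pos, eventually_ge_atTop 1, hm.eventually_ge_atTop 1,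
      hm.eventually (hM.card_tendsto.eventually_ge_atTop 2), g₂.generator_pos]
      with n h2 h3 h4 h5 h6 h7 h8
    by_contra! hlt
    have h9 := div_peakRate_le h1 h6 hlt.le h7 (hmono hlt.le) (hC _ _ hlt.le)
    have hn0 : (0 : ℝ) < n := by exact_mod_cast h5
    simp only [Pi.div_apply] at h2
    rw [lt_div_iff₀ (by positivity)] at h2
    have h10 := mul_lt_mul_of_pos_right h3 (div_pos hn0 h8)
    have h11 : r * (peakRate α₂ (k n) / c n) * (n / peakRate α₂ (k n)) = r * (n / c n) := by
      field_simp
    rw [h11] at h10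
    linarith
  refine tendsto_atTop_mono' _ ?_ hdiv
  filter_upwards [hnm, hg.generator_pos, hM.card_tendsto.eventually_ge_atTop K₀] with n h2 h3 h4
  have := (hK₀ _ _ h4 (hmono h2)).2
  gcongr

end Efficiency

end PowerDivergence

theorem theorem2 (α₁ α₂ : ℝ) (hα₁ : 0 < α₁) (hα : α₁ < α₂)
    (k : ℕ → ℕ) (P Q : (n : ℕ) → Fin (k n) → ℝ) (Δ₁ Δ₂ : ℝ)
    (hA : PowerDivergence.Assumptions k P Q α₁ α₂ Δ₁ Δ₂) :
    (Tendsto (fun n : ℕ => (k n : ℝ) * Real.log n / n) atTop (𝓝 0) →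
      (α₂ < 1 → 0 < 1 + α₂ * (α₂ - 1) * Δ₂ → ∀ B : ENNReal,
        PowerDivergence.IsBahadurEfficiency k P Q α₁ α₂ Δ₁ Δ₂ B ↔
          B = ENNReal.ofReal ((α₂ - 1) / (α₁ - 1) *
            (Real.log (1 + α₁ * (α₁ - 1) * Δ₁) / Real.log (1 + α₂ * (α₂ - 1) * Δ₂)))) ∧
      (α₂ = 1 → ∀ B : ENNReal,
        PowerDivergence.IsBahadurEfficiency k P Q α₁ α₂ Δ₁ Δ₂ B ↔
          B = ENNReal.ofReal (1 / (α₁ - 1) * (Real.log (1 + α₁ * (α₁ - 1) * Δ₁) / Δ₂)))) ∧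
    (Monotone k → (∀ n, 1 ≤ n → ∀ j, Q n j = 1 / (k n : ℝ)) →
      Tendsto (fun n : ℕ => (k n : ℝ) ^ (2 - 1 / α₂) * Real.log n / n) atTop (𝓝 0) →
      1 < α₂ →
        PowerDivergence.IsBahadurEfficiency k P Q α₁ α₂ Δ₁ Δ₂ ⊤ ∧
        ((α₁ ≤ 1 ∨ ∃ C : ℝ, ∀ m n : ℕ, m ≤ n → (m : ℝ) * k n ≤ C * ((n : ℝ) * k m)) →
          ∀ B : ENNReal,
            PowerDivergence.IsBahadurEfficiency k P Q α₁ α₂ Δ₁ Δ₂ B → B = ⊤)) := by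

  refine ⟨fun hk => ⟨fun h1 hΔ B => ?_, fun h1 B => ?_⟩, fun hmono hU hk h1 => ⟨?_, ?_⟩⟩
  · rw [PowerDivergence.isBahadurEfficiency_iff_of_le_one hA hα₁ hα h1.le
      (PowerDivergence.mem_levels_of_lt_one hA hα₁ hα h1 hΔ) ⟨hA.identifiable₂.pos, hΔ⟩ hk,
      PowerDivergence.renyiLevel, PowerDivergence.renyiLevel, if_neg (hα.trans h1).ne,
      if_neg h1.ne, div_div_div_eq, mul_comm (Real.log _) (α₂ - 1), mul_div_mul_comm]
  · subst h1
    rw [PowerDivergence.isBahadurEfficiency_iff_of_le_one hA hα₁ hα le_rfl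
      (PowerDivergence.mem_levels_of_one_le hA hα₁ le_rfl)
      (PowerDivergence.levels_of_one_lt le_rfl hA.identifiable₂.pos) hk,
      PowerDivergence.renyiLevel, PowerDivergence.renyiLevel, if_neg hα.ne, if_pos rfl,
      div_div, one_div_mul_eq_div, div_div, mul_comm Δ₂]
  · exact PowerDivergence.isBahadurEfficiency_top hA hα₁ hα h1 hmono hU hk
  · exact fun hC B hB => PowerDivergence.IsBahadurEfficiency.eq_top hA hα₁ hα h1 hmono hU hk hC hB
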